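/- Let $d\ge 1$, $\alpha=(\alpha_1,\dots,\alpha_d)\in[0,\infty)^d$, $X=(0,\infty)^d$ with Lebesgue measure, and let functions be real- or complex-valued. For $k\in\mathbb N^d$ let $$\mathcal L_k^\alpha(x)=\prod_{i=1}^d\Big(\frac{\Gamma(k_i+1)}{\Gamma(k_i+\alpha_i+1)}\Big)^{1/2}L_{k_i}^{\alpha_i}(x_i)\,x_i^{\alpha_i/2}e^{-x_i/2},\qquad x\in X,$$ be the standard Laguerre functions, where $L_n^a$ is the Laguerre polynomial of degree $n$ and order $a$. They form an orthonormal basis of $L^2(X)$ consisting of eigenfunctions of $$L_\alpha^{\mathcal L}=-\sum_{i=1}^d\Big(x_i\frac{\partial^2}{\partial x_i^2}+\frac{\partial}{\partial x_i}-\frac{x_i^2+\alpha_i^2}{4x_i}\Big),\qquad L_\alpha^{\mathcal L}\mathcal L_k^\alpha=\lambda_k\mathcal L_k^\alpha,\qquad \lambda_k=|k|+\frac{|\alpha|+d}{2},$$ where $|k|=\sum_i k_i$ and $|\alpha|=\sum_i\alpha_i$. Denote also by $L_\alpha^{\mathcal L}$ the self-adjoint extension whose spectral decomposition is given by the $\mathcal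 L_k^\alpha$, so that for $t\ge0$ $$T_t^{\alpha,\mathcal L}f=\exp(-tL_\alpha^{\mathcal L})f=\sum_{k\in\mathbb N^d}e^{-t\lambda_k}\langle f,\mathcal L_k^\alpha\rangle\,\mathcal L_k^\alpha,\qquad f\in L^2(X).$$ The action of $T_t^{\alpha,\mathcal L}$, $t>0$, extends to $L^1(X)+L^\infty(X)$ by $$T_t^{\alpha,\mathcal L}f(x)=\int_X G_t(x,y)f(y)\,dy,\qquad G_t(x,y)=\sum_{k\in\mathbb N^d}e^{-t\lambda_k}\mathcal L_k^\alpha(x)\mathcal L_k^\alpha(y),$$ the integral being absolutely convergent for all $x\in X$; put $T_0^{\alpha,\mathcal L}=\mathrm{Id}$. (Thus there is exactly one family of linear operators on $L^1(X)+L^\infty(X)$ with these properties.) Then $\{T_t^{\alpha,\mathcal L}\}_{t\ge0}$ is a submarkovian, but not Markovian, symmetric diffusion semigroup, and for every $1\le p\le\infty$ and $t>0$, $$\|T_t^{\alpha,\mathcal L}\|_{p\to p}\le\big(\cosh(t/2)\big)^{-d}.$$ Here a symmetric diffusion semigroup is a family $\{T_t\}_{t\ge0}$ of linear operators on $L^1+L^\infty$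 with $T_0=\mathrm{Id}$ such that (i) for each $1\le p\le\infty$ every $T_t$ is a contraction on $L^p$ and $\{T_t\}$ is a semigroup there, (ii) every $T_t$ is self-adjoint in $L^2$, (iii) $T_tf\to f$ in $L^2$ as $t\to0^+$ for each $f\in L^2$. It is Markovian if moreover (iv) $T_tf\ge0$ whenever $f\ge0$, and (v) $T_t\mathbf 1=\mathbf 1$ for all $t$; it is submarkovian if (iv) holds and $T_t\mathbf 1\le\mathbf 1$ for all $t$. -/

import Mathlib

open MeasureTheory Filter Topology
open scoped NNReal ENNReal ComplexOrder

section DiffusionSemigroups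

variable {X : Type*} [MeasurableSpace X]

/-- A linear operator `T`, defined on a linear space `D` of classes of measurable functions, maps
`L^p` (which has to lie in `D`) into itself, and there it is the bounded operator `A`. -/
def ActsOnLpAs {𝕜 : Type*} [RCLike 𝕜] {μ : Measure X} {D : Submodule 𝕜 (X →ₘ[μ] 𝕜)}
    (T : D →ₗ[𝕜] (X →ₘ[μ] 𝕜)) (p : ℝ≥0∞) [Fact (1 ≤ p)] (A : Lp 𝕜 p μ →L[𝕜] Lp 𝕜 p μ) : Prop :=
  ∀ f : Lp 𝕜 p μ, ∃ hf : (f : X →ₘ[μ] 𝕜) ∈ D, T ⟨f, hf⟩ = (A f : X →ₘ[μ] 𝕜)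

/-- Symmetric diffusion semigroups on a measure space, acting from a linear space `D`
that contains all the `L^p` spaces, `1 ≤ p ≤ ∞`, to classes of measurable functions. -/
structure IsSymmetricDiffusionSemigroup {𝕜 : Type*} [RCLike 𝕜] {μ : Measure X}
    {D : Submodule 𝕜 (X →ₘ[μ] 𝕜)} (T : ℝ≥0 → D →ₗ[𝕜] (X →ₘ[μ] 𝕜)) : Prop where
  /-- `T_0` is the identity. -/
  zero : T 0 = D.subtype
  /-- On each `L^p`, the operators are contractions and form a semigroup. -/
  contraction_semigroup : ∀ (p : ℝ≥0∞) [Fact (1 ≤ p)],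
    ∃ A : ℝ≥0 → (Lp 𝕜 p μ →L[𝕜] Lp 𝕜 p μ),
      (∀ t, ActsOnLpAs (T t) p (A t)) ∧ (∀ t, ‖A t‖ ≤ 1) ∧
      A 0 = ContinuousLinearMap.id 𝕜 (Lp 𝕜 p μ) ∧ ∀ s t, A (s + t) = (A s).comp (A t)
  /-- Each operator is self-adjoint in `L^2`. -/
  selfAdjoint : ∀ (t : ℝ≥0) (A : Lp 𝕜 2 μ →L[𝕜] Lp 𝕜 2 μ), ActsOnLpAs (T t) 2 A → IsSelfAdjoint A
  /-- Strong continuity at `0` in `L^2`. -/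
  tendsto_zero : ∀ A : ℝ≥0 → (Lp 𝕜 2 μ →L[𝕜] Lp 𝕜 2 μ), (∀ t, ActsOnLpAs (T t) 2 (A t)) →
    ∀ f : Lp 𝕜 2 μ, Tendsto (fun t => A t f) (𝓝[>] 0) (𝓝 f)

/-- Positive and conservative symmetric diffusion semigroups. -/
structure IsMarkovian {𝕜 : Type*} [RCLike 𝕜] {μ : Measure X}
    {D : Submodule 𝕜 (X →ₘ[μ] 𝕜)} (T : ℝ≥0 → D →ₗ[𝕜] (X →ₘ[μ] 𝕜)) : Prop
    extends IsSymmetricDiffusionSemigroup T where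
  positive : ∀ (t : ℝ≥0) (f : D), 0 ≤ (f : X →ₘ[μ] 𝕜) → 0 ≤ T t f
  conservative : ∀ t : ℝ≥0, ∃ h : (1 : X →ₘ[μ] 𝕜) ∈ D, T t ⟨1, h⟩ = 1

/-- Positive symmetric diffusion semigroups with `T_t 1 ≤ 1`. -/
structure IsSubmarkovian {𝕜 : Type*} [RCLike 𝕜] {μ : Measure X}
    {D : Submodule 𝕜 (X →ₘ[μ] 𝕜)} (T : ℝ≥0 → D →ₗ[𝕜] (X →ₘ[μ] 𝕜)) : Prop
    extends IsSymmetricDiffusionSemigroup T where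
  positive : ∀ (t : ℝ≥0) (f : D), 0 ≤ (f : X →ₘ[μ] 𝕜) → 0 ≤ T t f
  map_one_le : ∀ t : ℝ≥0, ∃ h : (1 : X →ₘ[μ] 𝕜) ∈ D, T t ⟨1, h⟩ ≤ 1

/-- The linear space `L^1 + L^∞`. -/
def L1AddLinfty (𝕜 : Type*) [RCLike 𝕜] (μ : Measure X) : Submodule 𝕜 (X →ₘ[μ] 𝕜) :=
  Lp.LpSubmodule 𝕜 𝕜 1 μ ⊔ Lp.LpSubmodule 𝕜 𝕜 ∞ μ

end DiffusionSemigroups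

section Laguerre

/-- The Laguerre polynomial `L_k^a` of degree `k` and order `a > -1`. -/
noncomputable def laguerrePoly (a : ℝ) (k : ℕ) (x : ℝ) : ℝ :=
  ∑ j ∈ Finset.range (k + 1),
    (-1) ^ j * Real.Gamma (k + a + 1) /
      (Real.Gamma (j + a + 1) * (Nat.factorial j : ℝ) * (Nat.factorial (k - j) : ℝ)) * x ^ j

/-- The standard Laguerre function of degree `k` and order `a` in one variable. -/
noncomputable def laguerreFun1 (a : ℝ) (k : ℕ) (x : ℝ) : ℝ :=
  Real.sqrt (Real.Gamma (k + 1) / Real.Gamma (k + a + 1)) * laguerrePoly a k x *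
    x ^ (a / 2) * Real.exp (-x / 2)

/-- The standard Laguerre functions in `d` variables: tensor products. -/
noncomputable def laguerreFun {d : ℕ} (α : Fin d → ℝ) (k : Fin d → ℕ) (x : Fin d → ℝ) : ℝ :=
  ∏ i, laguerreFun1 (α i) (k i) (x i)

/-- The open orthant `(0, ∞)^d`. -/
def orthant (d : ℕ) : Set (Fin d → ℝ) := {x | ∀ i, 0 < x i}

/-- Lebesgue measure on the open orthant. -/
noncomputable def orthantMeasure (d : ℕ) : Measure (Fin d → ℝ) := volume.restrict (orthant d)

/-- The Laguerre differential operator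
`-∑ i, (x_i ∂_i² + ∂_i - (x_i² + α_i²) / (4 x_i))`, applied to `u` at the point `x`. -/
noncomputable def laguerreDiffOp {d : ℕ} (α : Fin d → ℝ) (u : (Fin d → ℝ) → ℝ)
    (x : Fin d → ℝ) : ℝ :=
  -∑ i, (x i * iteratedDeriv 2 (fun s => u (Function.update x i s)) (x i) +
    deriv (fun s => u (Function.update x i s)) (x i) -
    (x i ^ 2 + α i ^ 2) / (4 * x i) * u x)

/-- The number `|k| + (|α| + d) / 2`. -/
noncomputable def laguerreEigenvalue {d : ℕ} (α : Fin d → ℝ) (k : Fin d → ℕ) : ℝ :=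
  (∑ i, (k i : ℝ)) + ((∑ i, α i) + d) / 2

/-- `S = exp(-tL)` on `L^2((0, ∞)^d)`, where `L` is the self-adjoint extension of the Laguerre
differential operator whose spectral decomposition is given by the Laguerre functions: these form an
orthonormal basis consisting of eigenfunctions of the differential operator, and `S` is given
by the spectral theorem. -/
def IsLaguerreExp {𝕜 : Type*} [RCLike 𝕜] {d : ℕ} (α : Fin d → ℝ) (t : ℝ)
    (S : Lp 𝕜 2 (orthantMeasure d) →L[𝕜] Lp 𝕜 2 (orthantMeasure d)) : Prop :=
  (∀ k, ∀ x ∈ orthant d,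
      laguerreDiffOp α (laguerreFun α k) x = laguerreEigenvalue α k * laguerreFun α k x) ∧
  ∃ b : HilbertBasis (Fin d → ℕ) 𝕜 (Lp 𝕜 2 (orthantMeasure d)),
    (∀ k, (b k : (Fin d → ℝ) → 𝕜) =ᵐ[orthantMeasure d] fun x => (laguerreFun α k x : 𝕜)) ∧
    ∀ f, HasSum
      (fun k => (Real.exp (-t * laguerreEigenvalue α k) : 𝕜) • (inner 𝕜 (b k) f) • b k) (S f)

/-- The heat kernel `G_t(x, y) = ∑ k, exp(-t (|k| + (|α| + d) / 2)) 𝓛_k(x) 𝓛_k(y)`. -/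
noncomputable def laguerreKernel {d : ℕ} (α : Fin d → ℝ) (t : ℝ) (x y : Fin d → ℝ) : ℝ :=
  ∑' k : Fin d → ℕ,
    Real.exp (-t * laguerreEigenvalue α k) * laguerreFun α k x * laguerreFun α k y

/-- `T` is the standard Laguerre function semigroup: it is `exp(-tL)` on `L^2`, and its
action on `L^1 + L^∞` is, for `t > 0`, integration against the heat kernel (with convergent
integrals at all points of the orthant), while `T_0` is the identity. -/
structure IsLaguerreSemigroup {𝕜 : Type*} [RCLike 𝕜] {d : ℕ} (α : Fin d → ℝ)
    (T : ℝ≥0 → L1AddLinfty 𝕜 (orthantMeasure d) →ₗ[𝕜] ((Fin d → ℝ) →ₘ[orthantMeasure d] 𝕜)) :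
    Prop where
  zero : T 0 = (L1AddLinfty 𝕜 (orthantMeasure d)).subtype
  exp_on_L2 : ∀ t : ℝ≥0, ∃ S : Lp 𝕜 2 (orthantMeasure d) →L[𝕜] Lp 𝕜 2 (orthantMeasure d),
    ActsOnLpAs (T t) 2 S ∧ IsLaguerreExp α t S
  integrable_kernel : ∀ t : ℝ≥0, 0 < t → ∀ f : L1AddLinfty 𝕜 (orthantMeasure d),
    ∀ x ∈ orthant d, Integrable
      (fun y => (laguerreKernel α t x y : 𝕜) * (f : (Fin d → ℝ) →ₘ[orthantMeasure d] 𝕜) y)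
      (orthantMeasure d)
  eq_integral : ∀ t : ℝ≥0, 0 < t → ∀ f : L1AddLinfty 𝕜 (orthantMeasure d),
    (T t f : (Fin d → ℝ) → 𝕜) =ᵐ[orthantMeasure d] fun x =>
      ∫ y, (laguerreKernel α t x y : 𝕜) * (f : (Fin d → ℝ) →ₘ[orthantMeasure d] 𝕜) y
        ∂(orthantMeasure d)

end Laguerre

/-!
By the Hille–Hardy formula the heat kernel is a product of one-dimensional kernels in closed form,
built from the modified Bessel series; in particular it is positive, symmetric and bounded.
Integrating the series termwise and using `Γ (m + a / 2 + 1) ^ 2 ≤ m! Γ (m + a + 1)`, which is the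
logarithmic convexity of the Gamma function, bounds the mass of `G_t(x, ·)` by
`cosh (t / 2) ^ (-d)`; this is where `a ≥ 0` enters. The Schur test turns the bound on the mass into
the bound on `L^p`. Since it is less than `1` for `t > 0`, constants are not preserved.

The orthonormality of the Laguerre functions makes `G_t` reproduce itself under composition and
diagonalizes the operators on `L^2`. For the completeness, the generating function of the Laguerre
functions shows that a function orthogonal to all of them, times the first of them, integrates to
zero against every `exp (-∑ i, n i * y i)`, and these exponentials span a separating algebra.
-/

/-! ### Laguerre polynomials and the differential equation -/

section LaguerrePolynomial

open Polynomial

variable {a : ℝ}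

theorem Gamma_add_natCast {c : ℝ} (hc : ∀ m : ℕ, c + m ≠ 0) (n : ℕ) :
    Real.Gamma (c + n) = Real.Gamma c * (ascPochhammer ℝ n).eval c := by
  induction n with
  | zero => simp
  | succ n ih =>
    rw [ascPochhammer_succ_eval, ← mul_assoc, ← ih, Nat.cast_succ, ← add_assoc,
      Real.Gamma_add_one (hc n), mul_comm]

theorem natCast_add_add_one_pos (ha : -1 < a) (n : ℕ) : 0 < (n : ℝ) + a + 1 := by
  linarith [n.cast_nonneg (α := ℝ)]

theorem Gamma_natCast_add_add_one_pos (ha : -1 < a) (n : ℕ) : 0 < Real.Gamma (n + a + 1) :=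
  Real.Gamma_pos_of_pos (natCast_add_add_one_pos ha n)

/-- The coefficient of `x ^ j` in the Laguerre polynomial `L_k^a`, for `j ≤ k`; for `j > k` it is a
junk value. -/
noncomputable def laguerreCoeff (a : ℝ) (k j : ℕ) : ℝ :=
  (-1) ^ j * Real.Gamma (k + a + 1) /
    (Real.Gamma (j + a + 1) * (Nat.factorial j : ℝ) * (Nat.factorial (k - j) : ℝ))

/-- The Laguerre polynomial `L_k^a` as an element of `ℝ[X]`. -/
noncomputable def laguerrePolynomial (a : ℝ) (k : ℕ) : ℝ[X] :=
  ∑ j ∈ Finset.range (k + 1), monomial j (laguerreCoeff a k j)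

theorem eval_laguerrePolynomial (a : ℝ) (k : ℕ) (x : ℝ) :
    (laguerrePolynomial a k).eval x = laguerrePoly a k x := by
  simp [laguerrePolynomial, laguerrePoly, eval_finsetSum, laguerreCoeff]

theorem coeff_laguerrePolynomial (a : ℝ) (k j : ℕ) :
    (laguerrePolynomial a k).coeff j = if j ≤ k then laguerreCoeff a k j else 0 := by
  simp [laguerrePolynomial, coeff_monomial]

theorem coeff_laguerrePolynomial_of_le (a : ℝ) {k j : ℕ} (hj : j ≤ k) :
    (laguerrePolynomial a k).coeff j = laguerreCoeff a k j := by
  rw [coeff_laguerrePolynomial, if_pos hj]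

theorem natDegree_laguerrePolynomial_le (a : ℝ) (k : ℕ) :
    (laguerrePolynomial a k).natDegree ≤ k := by
  refine natDegree_le_iff_coeff_eq_zero.2 fun n hn => ?_
  rw [coeff_laguerrePolynomial, if_neg hn.not_ge]

theorem laguerreCoeff_succ (ha : -1 < a) {k j : ℕ} (hj : j < k) :
    (j + 1) * (j + a + 1) * laguerreCoeff a k (j + 1) = -(k - j) * laguerreCoeff a k j := by
  obtain ⟨m, rfl⟩ : ∃ m, k = j + 1 + m := ⟨k - (j + 1), by omega⟩
  have hpos : 0 < (j : ℝ) + a + 1 := natCast_add_add_one_pos ha j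
  have hGamma : Real.Gamma (j + a + 1) ≠ 0 := (Gamma_natCast_add_add_one_pos ha j).ne'
  have hGamma_succ : Real.Gamma ((j + 1 : ℕ) + a + 1) =
      (j + a + 1) * Real.Gamma (j + a + 1) := by
    rw [← Real.Gamma_add_one hpos.ne']
    push_cast
    ring_nf
  simp only [laguerreCoeff]
  rw [hGamma_succ, show j + 1 + m - (j + 1) = m by omega, show j + 1 + m - j = m + 1 by omega,
    Nat.factorial_succ j, Nat.factorial_succ m]
  push_cast
  field_simp
  ring

theorem coeff_laguerrePolynomial_succ (ha : -1 < a) (k n : ℕ) :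
    (n + 1) * (n + a + 1) * (laguerrePolynomial a k).coeff (n + 1) =
      -(k - n) * (laguerrePolynomial a k).coeff n := by
  simp only [coeff_laguerrePolynomial]
  rcases lt_trichotomy n k with h | rfl | h
  · rw [if_pos (by omega), if_pos h.le, laguerreCoeff_succ ha h]
  · simp
  · rw [if_neg (by omega), if_neg (by omega)]
    simp

theorem laguerrePolynomial_ode (ha : -1 < a) (k : ℕ) :
    X * derivative (derivative (laguerrePolynomial a k)) +
      (C (a + 1) - X) * derivative (laguerrePolynomial a k) + C (k : ℝ) * laguerrePolynomial a k =
      0 := by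
  ext n
  have hrec := coeff_laguerrePolynomial_succ ha k n
  cases n with
  | zero =>
    simp [sub_mul, coeff_derivative] at hrec ⊢
    linarith
  | succ n =>
    simp [sub_mul, add_mul, coeff_derivative] at hrec ⊢
    linarith

theorem hasDerivAt_mul_rpow_mul_exp {g : ℝ → ℝ} {g' x : ℝ} (b : ℝ) (hx : 0 < x)
    (hg : HasDerivAt g g' x) :
    HasDerivAt (fun s => g s * (s ^ b * Real.exp (-s / 2)))
      ((g' + g x * (b / x - 1 / 2)) * (x ^ b * Real.exp (-x / 2))) x := by
  have hrpow : HasDerivAt (fun s : ℝ => s ^ b) (b * x ^ (b - 1)) x :=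
    Real.hasDerivAt_rpow_const (Or.inl hx.ne')
  have hexp : HasDerivAt (fun s : ℝ => Real.exp (-s / 2)) (Real.exp (-x / 2) * (-1 / 2)) x :=
    ((hasDerivAt_id x).neg.div_const 2).exp
  refine (hg.mul (hrpow.mul hexp)).congr_deriv ?_
  simp only [Pi.mul_apply]
  rw [Real.rpow_sub_one hx.ne']
  field_simp
  ring

/-- Conjugation by the square root `x ^ (a / 2) * exp (-x / 2)` of the weight turns the operator of
the Laguerre functions into the one of the Laguerre polynomials. -/
theorem laguerreOp_eval_mul_rpow_mul_exp (a : ℝ) (P : ℝ[X]) {x : ℝ} (hx : 0 < x)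
    {u : ℝ → ℝ} (hu : u = fun s => P.eval s * (s ^ (a / 2) * Real.exp (-s / 2))) :
    x * iteratedDeriv 2 u x + deriv u x - (x ^ 2 + a ^ 2) / (4 * x) * u x =
      (X * derivative (derivative P) + (C (a + 1) - X) * derivative P -
        C ((a + 1) / 2) * P).eval x * (x ^ (a / 2) * Real.exp (-x / 2)) := by
  set g : ℝ → ℝ := fun y => P.derivative.eval y + P.eval y * (a / 2 / y - 1 / 2) with hg
  have hderiv : ∀ y, 0 < y → HasDerivAt u (g y * (y ^ (a / 2) * Real.exp (-y / 2))) y :=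
    fun y hy => hu ▸ hasDerivAt_mul_rpow_mul_exp (a / 2) hy (P.hasDerivAt y)
  have hderiv_g : HasDerivAt g (P.derivative.derivative.eval x +
      (P.derivative.eval x * (a / 2 / x - 1 / 2) + P.eval x * (-(a / 2) / x ^ 2))) x := by
    have hdiv : HasDerivAt (fun y => a / 2 / y - 1 / 2) (-(a / 2) / x ^ 2) x :=
      (((hasDerivAt_const x (a / 2)).div (hasDerivAt_id x) hx.ne').sub_const _).congr_deriv
        (by simp)
    exact (P.derivative.hasDerivAt x).add ((P.hasDerivAt x).mul hdiv)
  have hderiv2 := hasDerivAt_mul_rpow_mul_exp (a / 2) hx hderiv_g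
  have hderiv_eq : deriv u =ᶠ[𝓝 x] fun y => g y * (y ^ (a / 2) * Real.exp (-y / 2)) := by
    filter_upwards [lt_mem_nhds hx] with y hy using (hderiv y hy).deriv
  rw [iteratedDeriv_succ, iteratedDeriv_one, hderiv_eq.deriv_eq, hderiv2.deriv,
    (hderiv x hx).deriv, hu]
  simp only [hg, eval_add, eval_sub, eval_mul, eval_X, eval_C]
  field_simp
  ring

theorem laguerreFun1_eq (a : ℝ) (k : ℕ) :
    laguerreFun1 a k = fun x => √(Real.Gamma (k + 1) / Real.Gamma (k + a + 1)) *
      ((laguerrePolynomial a k).eval x * (x ^ (a / 2) * Real.exp (-x / 2))) := by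
  ext x
  simp only [laguerreFun1, eval_laguerrePolynomial]
  ring

theorem measurable_laguerreFun1 (a : ℝ) (k : ℕ) : Measurable (laguerreFun1 a k) := by
  rw [laguerreFun1_eq]
  have := (laguerrePolynomial a k).continuous.measurable
  fun_prop

theorem laguerreFun1_ode (ha : -1 < a) (k : ℕ) {x : ℝ} (hx : 0 < x) :
    x * iteratedDeriv 2 (laguerreFun1 a k) x + deriv (laguerreFun1 a k) x -
      (x ^ 2 + a ^ 2) / (4 * x) * laguerreFun1 a k x =
      -(k + (a + 1) / 2) * laguerreFun1 a k x := by
  have hode := congrArg (eval x) (laguerrePolynomial_ode ha k)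
  have hconj := laguerreOp_eval_mul_rpow_mul_exp a (laguerrePolynomial a k) hx rfl
  simp only [eval_add, eval_sub, eval_mul, eval_X, eval_C, eval_zero] at hode hconj
  rw [laguerreFun1_eq, iteratedDeriv_const_mul_field, deriv_const_mul_field]
  linear_combination √(Real.Gamma (k + 1) / Real.Gamma (k + a + 1)) * hconj +
    √(Real.Gamma (k + 1) / Real.Gamma (k + a + 1)) * (x ^ (a / 2) * Real.exp (-x / 2)) * hode

theorem laguerreDiffOp_prod {d : ℕ} {α ev x : Fin d → ℝ} {u : Fin d → ℝ → ℝ}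
    (hu : ∀ i, x i * iteratedDeriv 2 (u i) (x i) + deriv (u i) (x i) -
      (x i ^ 2 + α i ^ 2) / (4 * x i) * u i (x i) = -ev i * u i (x i)) :
    laguerreDiffOp α (fun y => ∏ i, u i (y i)) x = (∑ i, ev i) * ∏ i, u i (x i) := by
  have hupdate : ∀ i, (fun s => ∏ j, u j (Function.update x i s j)) =
      fun s => (∏ j ∈ Finset.univ.erase i, u j (x j)) * u i s := by
    intro i
    ext s
    rw [← Finset.prod_erase_mul _ _ (Finset.mem_univ i), Function.update_self]
    congr 1
    exact Finset.prod_congr rfl fun j hj => by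
      rw [Function.update_of_ne (Finset.ne_of_mem_erase hj)]
  unfold laguerreDiffOp
  rw [← Finset.sum_neg_distrib, Finset.sum_mul]
  refine Finset.sum_congr rfl fun i _ => ?_
  have hprod := Finset.prod_erase_mul _ (fun j => u j (x j)) (Finset.mem_univ i)
  simp only [hupdate, iteratedDeriv_const_mul_field, deriv_const_mul_field, ← hprod]
  linear_combination -(∏ j ∈ Finset.univ.erase i, u j (x j)) * hu i

theorem laguerreDiffOp_laguerreFun {d : ℕ} {α : Fin d → ℝ} (hα : ∀ i, -1 < α i)
    (k : Fin d → ℕ) {x : Fin d → ℝ} (hx : x ∈ orthant d) :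
    laguerreDiffOp α (laguerreFun α k) x = laguerreEigenvalue α k * laguerreFun α k x := by
  have hsum : laguerreEigenvalue α k = ∑ i, (k i + (α i + 1) / 2) := by
    simp [laguerreEigenvalue, Finset.sum_add_distrib, ← Finset.sum_div]
  rw [hsum]
  exact laguerreDiffOp_prod fun i => laguerreFun1_ode (hα i) (k i) (hx i)

end LaguerrePolynomial

/-! ### Orthogonality -/

section Orthogonality

open Polynomial

variable {a : ℝ}

theorem pow_mul_rpow_mul_exp_neg {y : ℝ} (hy : 0 < y) (a : ℝ) (n : ℕ) :
    y ^ n * (y ^ a * Real.exp (-y)) = Real.exp (-y) * y ^ (n + a + 1 - 1) := by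
  rw [add_sub_cancel_right, Real.rpow_add hy, Real.rpow_natCast]
  ring

theorem integrableOn_pow_mul_rpow_mul_exp_neg (ha : -1 < a) (n : ℕ) :
    IntegrableOn (fun y : ℝ => y ^ n * (y ^ a * Real.exp (-y))) (Set.Ioi 0) :=
  (Real.GammaIntegral_convergent (natCast_add_add_one_pos ha n)).congr_fun
    (fun _ hy => (pow_mul_rpow_mul_exp_neg hy a n).symm) measurableSet_Ioi

theorem integral_pow_mul_rpow_mul_exp_neg (ha : -1 < a) (n : ℕ) :
    ∫ y in Set.Ioi (0 : ℝ), y ^ n * (y ^ a * Real.exp (-y)) = Real.Gamma (n + a + 1) := by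
  rw [Real.Gamma_eq_integral (natCast_add_add_one_pos ha n)]
  exact setIntegral_congr_fun measurableSet_Ioi fun _ hy => pow_mul_rpow_mul_exp_neg hy a n

theorem integrableOn_eval_mul_rpow_mul_exp_neg (ha : -1 < a) (Q : ℝ[X]) :
    IntegrableOn (fun y : ℝ => Q.eval y * (y ^ a * Real.exp (-y))) (Set.Ioi 0) := by
  simp only [eval_eq_sum_range, Finset.sum_mul, mul_assoc]
  exact integrable_finsetSum _ fun n _ => (integrableOn_pow_mul_rpow_mul_exp_neg ha n).const_mul _

theorem integral_eval_mul_rpow_mul_exp_neg (ha : -1 < a) (Q : ℝ[X]) {n : ℕ}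
    (hn : Q.natDegree < n) :
    ∫ y in Set.Ioi (0 : ℝ), Q.eval y * (y ^ a * Real.exp (-y)) =
      ∑ j ∈ Finset.range n, Q.coeff j * Real.Gamma (j + a + 1) := by
  simp only [eval_eq_sum_range' hn, Finset.sum_mul, mul_assoc]
  rw [integral_finsetSum _ fun n _ => (integrableOn_pow_mul_rpow_mul_exp_neg ha n).const_mul _]
  simp only [integral_const_mul, integral_pow_mul_rpow_mul_exp_neg ha]

theorem integral_pow_mul_laguerrePolynomial (ha : -1 < a) (i k : ℕ) :
    ∫ y in Set.Ioi (0 : ℝ), y ^ i * ((laguerrePolynomial a k).eval y * (y ^ a * Real.exp (-y))) =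
      ∑ j ∈ Finset.range (k + 1), laguerreCoeff a k j * Real.Gamma ((i + j : ℕ) + a + 1) := by
  have hdeg : (X ^ i * laguerrePolynomial a k).natDegree < i + (k + 1) := by
    refine natDegree_mul_le.trans_lt ?_
    rw [natDegree_X_pow]
    exact Nat.add_lt_add_left (Nat.lt_succ_of_le (natDegree_laguerrePolynomial_le a k)) i
  have h := integral_eval_mul_rpow_mul_exp_neg ha _ hdeg
  simp only [eval_mul, eval_pow, eval_X, mul_assoc] at h
  rw [h, Finset.sum_range_add, Finset.sum_eq_zero, zero_add]
  · refine Finset.sum_congr rfl fun j hj => ?_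
    rw [coeff_X_pow_mul', if_pos (by omega), Nat.add_sub_cancel_left,
      coeff_laguerrePolynomial_of_le _ (Finset.mem_range_succ_iff.1 hj)]
  · intro j hj
    rw [coeff_X_pow_mul', if_neg (Finset.mem_range.1 hj).not_ge, zero_mul]

theorem laguerreCoeff_mul_Gamma (ha : -1 < a) (i : ℕ) {k j : ℕ} (hj : j ≤ k) :
    laguerreCoeff a k j * Real.Gamma ((i + j : ℕ) + a + 1) =
      Real.Gamma (k + a + 1) / Nat.factorial k * (-1) ^ k *
        ((-1) ^ (k - j) * (k.choose j : ℝ) * (ascPochhammer ℝ i).eval (j + (a + 1))) := by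
  have hpos := natCast_add_add_one_pos ha j
  have hGamma := (Gamma_natCast_add_add_one_pos ha j).ne'
  have hsign : (-1 : ℝ) ^ j = (-1) ^ k * (-1) ^ (k - j) := by
    obtain ⟨m, rfl⟩ := Nat.exists_eq_add_of_le hj
    rw [Nat.add_sub_cancel_left, pow_add, mul_assoc, ← mul_pow]
    simp
  rw [show ((i + j : ℕ) : ℝ) + a + 1 = (j + a + 1) + i by push_cast; ring,
    Gamma_add_natCast fun m => by positivity, Nat.cast_choose ℝ hj, laguerreCoeff, ← add_assoc,
    hsign]
  field_simp

/-- The moments of `L_k^a` are `k`-th finite differences of polynomials, which is why the low ones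
vanish. -/
theorem sum_laguerreCoeff_mul_Gamma (ha : -1 < a) (i k : ℕ) :
    ∑ j ∈ Finset.range (k + 1), laguerreCoeff a k j * Real.Gamma ((i + j : ℕ) + a + 1) =
      Real.Gamma (k + a + 1) / Nat.factorial k * (-1) ^ k *
        ((fwdDiff (1 : ℝ))^[k] ((ascPochhammer ℝ i).comp (X + C (a + 1))).eval) 0 := by
  rw [fwdDiff_iter_eq_sum_shift, Finset.mul_sum]
  refine Finset.sum_congr rfl fun j hj => ?_
  rw [laguerreCoeff_mul_Gamma ha i (Finset.mem_range_succ_iff.1 hj)]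
  simp [zsmul_eq_mul]

theorem natDegree_ascPochhammer_comp_X_add_C (i : ℕ) (c : ℝ) :
    ((ascPochhammer ℝ i).comp (X + C c)).natDegree = i := by
  rw [natDegree_comp, ascPochhammer_natDegree, natDegree_X_add_C, mul_one]

theorem integral_pow_mul_laguerrePolynomial_of_lt (ha : -1 < a) {i k : ℕ} (hik : i < k) :
    ∫ y in Set.Ioi (0 : ℝ), y ^ i * ((laguerrePolynomial a k).eval y * (y ^ a * Real.exp (-y))) =
      0 := by
  rw [integral_pow_mul_laguerrePolynomial ha, sum_laguerreCoeff_mul_Gamma ha,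
    fwdDiff_iter_eq_zero_of_degree_lt (by rwa [natDegree_ascPochhammer_comp_X_add_C]),
    Pi.zero_apply, mul_zero]

theorem integral_pow_mul_laguerrePolynomial_self (ha : -1 < a) (k : ℕ) :
    ∫ y in Set.Ioi (0 : ℝ), y ^ k * ((laguerrePolynomial a k).eval y * (y ^ a * Real.exp (-y))) =
      (-1) ^ k * Real.Gamma (k + a + 1) := by
  have hdiff := fwdDiff_iter_degree_eq_factorial ((ascPochhammer ℝ k).comp (X + C (a + 1)))
  rw [natDegree_ascPochhammer_comp_X_add_C,
    ((monic_ascPochhammer ℝ k).comp_X_add_C _).leadingCoeff] at hdiff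
  rw [integral_pow_mul_laguerrePolynomial ha, sum_laguerreCoeff_mul_Gamma ha, hdiff]
  simp only [Pi.smul_apply, Pi.natCast_apply, one_smul]
  field_simp

theorem integral_eval_mul_laguerrePolynomial (ha : -1 < a) (Q : ℝ[X]) {k : ℕ}
    (hQ : Q.natDegree ≤ k) :
    ∫ y in Set.Ioi (0 : ℝ), Q.eval y * ((laguerrePolynomial a k).eval y *
      (y ^ a * Real.exp (-y))) = Q.coeff k * ((-1) ^ k * Real.Gamma (k + a + 1)) := by
  have hint : ∀ i, IntegrableOn (fun y : ℝ =>
      y ^ i * ((laguerrePolynomial a k).eval y * (y ^ a * Real.exp (-y)))) (Set.Ioi 0) := fun i =>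
    (integrableOn_eval_mul_rpow_mul_exp_neg ha (X ^ i * laguerrePolynomial a k)).congr_fun
      (fun y _ => by simp only [eval_mul, eval_pow, eval_X, mul_assoc]) measurableSet_Ioi
  simp only [eval_eq_sum_range' (Nat.lt_succ_of_le hQ), Finset.sum_mul, mul_assoc]
  rw [integral_finsetSum _ fun i _ => (hint i).const_mul _]
  simp only [integral_const_mul]
  rw [Finset.sum_range_succ, Finset.sum_eq_zero fun i hi => by
      rw [integral_pow_mul_laguerrePolynomial_of_lt ha (Finset.mem_range.1 hi), mul_zero],
    zero_add, integral_pow_mul_laguerrePolynomial_self ha]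

theorem integral_laguerrePolynomial_mul (ha : -1 < a) {l k : ℕ} (hlk : l ≤ k) :
    ∫ y in Set.Ioi (0 : ℝ), (laguerrePolynomial a l).eval y * ((laguerrePolynomial a k).eval y *
      (y ^ a * Real.exp (-y))) =
      if l = k then Real.Gamma (k + a + 1) / Nat.factorial k else 0 := by
  rw [integral_eval_mul_laguerrePolynomial ha _ ((natDegree_laguerrePolynomial_le a l).trans hlk),
    coeff_laguerrePolynomial]
  rcases hlk.eq_or_lt with rfl | hlt
  · have hGamma := (Gamma_natCast_add_add_one_pos ha l).ne'
    rw [if_pos le_rfl, if_pos rfl, laguerreCoeff, Nat.sub_self, Nat.factorial_zero]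
    field_simp
    rw [← pow_mul, mul_comm l 2, pow_mul]
    simp
  · rw [if_neg hlt.not_ge, if_neg hlt.ne, zero_mul]

theorem laguerreFun1_mul_laguerreFun1 (a : ℝ) (k l : ℕ) {y : ℝ} (hy : 0 < y) :
    laguerreFun1 a k y * laguerreFun1 a l y =
      (√(Real.Gamma (k + 1) / Real.Gamma (k + a + 1)) *
        √(Real.Gamma (l + 1) / Real.Gamma (l + a + 1))) *
      ((laguerrePolynomial a k).eval y * ((laguerrePolynomial a l).eval y *
        (y ^ a * Real.exp (-y)))) := by
  have hrpow : y ^ a = y ^ (a / 2) * y ^ (a / 2) := by rw [← Real.rpow_add hy, add_halves]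
  have hexp : Real.exp (-y) = Real.exp (-y / 2) * Real.exp (-y / 2) := by
    rw [← Real.exp_add, add_halves]
  rw [hrpow, hexp, laguerreFun1_eq, laguerreFun1_eq]
  ring

theorem integrableOn_laguerreFun1_mul (ha : -1 < a) (k l : ℕ) :
    IntegrableOn (fun y => laguerreFun1 a k y * laguerreFun1 a l y) (Set.Ioi 0) := by
  refine IntegrableOn.congr_fun (Integrable.const_mul (integrableOn_eval_mul_rpow_mul_exp_neg ha
    (laguerrePolynomial a k * laguerrePolynomial a l))
    (√(Real.Gamma (k + 1) / Real.Gamma (k + a + 1)) *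
      √(Real.Gamma (l + 1) / Real.Gamma (l + a + 1)))) (fun y hy => ?_) measurableSet_Ioi
  simp only [laguerreFun1_mul_laguerreFun1 a k l hy, eval_mul, mul_assoc]

theorem integral_laguerreFun1_mul (ha : -1 < a) (k l : ℕ) :
    ∫ y in Set.Ioi (0 : ℝ), laguerreFun1 a k y * laguerreFun1 a l y = if k = l then 1 else 0 := by
  wlog hkl : k ≤ l generalizing k l
  · simp only [mul_comm (laguerreFun1 a k _), this l k (le_of_not_ge hkl), eq_comm]
  rw [setIntegral_congr_fun measurableSet_Ioi
    fun y hy => laguerreFun1_mul_laguerreFun1 a k l hy, integral_const_mul,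
    integral_laguerrePolynomial_mul ha hkl]
  split_ifs with h
  · subst h
    have hGamma := Gamma_natCast_add_add_one_pos ha k
    rw [Real.Gamma_nat_eq_factorial, Real.mul_self_sqrt (by positivity)]
    field_simp
  · rw [mul_zero]

end Orthogonality

/-! ### Generating functions and the Hille–Hardy formula -/

section DoubleSeries

theorem hasSum_sum_range_antidiagonal {F : ℕ × ℕ → ℝ} {S : ℝ} (hF : HasSum F S) :
    HasSum (fun n => ∑ j ∈ Finset.range (n + 1), F (j, n - j)) S := by
  have hsigma := (Finset.HasAntidiagonal.sigmaAntidiagonalEquivProd.hasSum_iff (f := F)).2 hF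
  refine (hsigma.sigma fun n => hasSum_fintype _).congr_fun fun n => ?_
  rw [← Finset.Nat.sum_antidiagonal_eq_sum_range_succ_mk, Finset.univ_eq_attach]
  exact (Finset.sum_attach _ fun p => F p).symm

theorem hasSum_mul_choose_mul {n : ℕ} (f : ℕ → ℝ) :
    HasSum (fun j => (n.choose j : ℝ) * f j)
      (∑ j ∈ Finset.range (n + 1), (n.choose j : ℝ) * f j) := by
  refine hasSum_sum_of_ne_finset_zero fun j hj => ?_
  rw [Nat.choose_eq_zero_of_lt (by simpa using hj), Nat.cast_zero, zero_mul]

theorem hasSum_choose_mul_pow_mul_pow (r v : ℝ) (n : ℕ) :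
    HasSum (fun j => (n.choose j : ℝ) * (r ^ (n - j) * v ^ j)) ((r + v) ^ n) := by
  have hbinomial : (r + v) ^ n =
      ∑ j ∈ Finset.range (n + 1), (n.choose j : ℝ) * (r ^ (n - j) * v ^ j) := by
    rw [add_comm, add_pow]
    exact Finset.sum_congr rfl fun j _ => by ring
  exact hbinomial ▸ hasSum_mul_choose_mul _

theorem summable_mul_choose_mul_pow_mul_pow {c : ℕ → ℝ} {r v : ℝ}
    (hc : Summable fun n => |c n| * (|r| + |v|) ^ n) :
    Summable fun p : ℕ × ℕ => c p.1 * ((p.1.choose p.2 : ℝ) * (r ^ (p.1 - p.2) * v ^ p.2)) := by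
  have hrow : ∀ n, HasSum
      (fun j => ‖c n * ((n.choose j : ℝ) * (r ^ (n - j) * v ^ j))‖) (|c n| * (|r| + |v|) ^ n) := by
    intro n
    simpa only [norm_mul, norm_pow, Real.norm_eq_abs, Nat.abs_cast] using
      (hasSum_choose_mul_pow_mul_pow |r| |v| n).mul_left |c n|
  refine Summable.of_norm ((summable_prod_of_nonneg fun _ => norm_nonneg _).2
    ⟨fun n => (hrow n).summable, ?_⟩)
  simpa only [(hrow _).tsum_eq] using hc

theorem eq_of_hasSum_mul_pow {f g : ℕ → ℝ} {F : ℝ → ℝ}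
    (hf : ∀ᶠ u in 𝓝 0, HasSum (fun j => f j * u ^ j) (F u))
    (hg : ∀ᶠ u in 𝓝 0, HasSum (fun j => g j * u ^ j) (F u)) : f = g := by
  have hasFPowerSeriesAt : ∀ h : ℕ → ℝ, (∀ᶠ u in 𝓝 0, HasSum (fun j => h j * u ^ j) (F u)) →
      HasFPowerSeriesAt F (FormalMultilinearSeries.ofScalars ℝ h) 0 := by
    intro h hh
    simpa only [hasFPowerSeriesAt_iff, zero_add, smul_eq_mul, mul_comm,
      FormalMultilinearSeries.coeff_ofScalars] using hh
  exact FormalMultilinearSeries.ofScalars_series_injective ℝ ℝ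
    ((hasFPowerSeriesAt f hf).eq_formalMultilinearSeries (hasFPowerSeriesAt g hg))

theorem hasSum_mul_choose_mul_pow_sub {c g : ℕ → ℝ} {F : ℝ → ℝ} {r ρ : ℝ} (hρ : 0 < ρ)
    (hF : ∀ s, |s| < |r| + ρ → HasSum (fun n => c n * s ^ n) (F s))
    (hg : ∀ v, |v| < ρ → HasSum (fun j => g j * v ^ j) (F (r + v))) (j : ℕ) :
    HasSum (fun n => c n * ((n.choose j : ℝ) * r ^ (n - j))) (g j) := by
  have hdouble : ∀ v, |v| < ρ → Summable fun p : ℕ × ℕ =>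
      c p.1 * ((p.1.choose p.2 : ℝ) * (r ^ (p.1 - p.2) * v ^ p.2)) := by
    intro v hv
    refine summable_mul_choose_mul_pow_mul_pow ?_
    have hpos : |(|r| + |v|)| = |r| + |v| := abs_of_nonneg (by positivity)
    refine (hF (|r| + |v|) (by linarith)).summable.norm.congr fun n => ?_
    rw [norm_mul, norm_pow, Real.norm_eq_abs, Real.norm_eq_abs, hpos]
  have hcolumn : ∀ j, Summable fun n => c n * ((n.choose j : ℝ) * r ^ (n - j)) := by
    intro j
    have hρ2 : (ρ / 2) ^ j ≠ 0 := by positivity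
    have h := (hdouble (ρ / 2) (by rw [abs_of_pos (by positivity)]; linarith)).prod_symm
    refine ((h.prod_factor j).mul_right ((ρ / 2) ^ j)⁻¹).congr fun n => ?_
    dsimp only [Prod.swap]
    field_simp
  have hsum : ∀ v, |v| < ρ → HasSum
      (fun j => (∑' n, c n * ((n.choose j : ℝ) * r ^ (n - j))) * v ^ j) (F (r + v)) := by
    intro v hv
    have htotal := (hdouble v hv).hasSum
    have hrow := htotal.prod_fiberwise fun n => (hasSum_choose_mul_pow_mul_pow r v n).mul_left (c n)
    rw [hrow.unique (hF (r + v) (by linarith [abs_add_le r v]))] at htotal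
    refine ((Equiv.prodComm ℕ ℕ).hasSum_iff.2 htotal).prod_fiberwise fun j => ?_
    refine ((hcolumn j).hasSum.mul_right (v ^ j)).congr_fun fun n => ?_
    simp only [Function.comp, Equiv.prodComm_apply, Prod.swap_prod_mk]
    ring
  have hnear : ∀ᶠ v in 𝓝 (0 : ℝ), |v| < ρ :=
    (continuous_abs.tendsto' (0 : ℝ) 0 abs_zero).eventually_lt_const hρ
  have hcoeff := eq_of_hasSum_mul_pow (F := fun v => F (r + v)) (hnear.mono hsum) (hnear.mono hg)
  exact congrFun hcoeff j ▸ (hcolumn j).hasSum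

end DoubleSeries

section GeneratingFunction

variable {a : ℝ}

theorem hasSum_Gamma_div_factorial_mul_pow {c s : ℝ} (hc : ∀ m : ℕ, c + m ≠ 0) (hs : |s| < 1) :
    HasSum (fun n : ℕ => Real.Gamma (n + c) / Nat.factorial n * s ^ n)
      (Real.Gamma c * (1 - s) ^ (-c)) := by
  have hmem : s ∈ Metric.eball (0 : ℝ) 1 := by
    simpa [Metric.mem_eball, edist_dist, dist_zero_right] using hs
  have h := ((Real.one_div_one_sub_rpow_hasFPowerSeriesOnBall_zero c).hasSum hmem).mul_left
    (Real.Gamma c)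
  simp only [FormalMultilinearSeries.ofScalars_apply_eq, zero_add, smul_eq_mul, one_div] at h
  rw [Real.rpow_neg (by linarith [(abs_lt.1 hs).2])]
  refine h.congr_fun fun n => ?_
  have hchoose : (Nat.factorial n : ℝ) * Ring.choose (c + n - 1) n =
      (ascPochhammer ℝ n).eval c := by
    rw [← Polynomial.ascPochhammer_smeval_eq_eval,
      ← Ring.factorial_nsmul_multichoose_eq_ascPochhammer, nsmul_eq_mul, Ring.multichoose_eq]
  rw [add_comm (n : ℝ) c, Gamma_add_natCast hc, ← hchoose]
  field_simp

theorem hasSum_pow_div_factorial (z : ℝ) :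
    HasSum (fun j : ℕ => z ^ j / Nat.factorial j) (Real.exp z) := by
  rw [Real.exp_eq_exp_ℝ]
  exact NormedSpace.expSeries_div_hasSum_exp z

/-- The term of bidegree `p` of the expansion of `∑ n, L_n^a(x) s ^ n` in powers of `x * s` and of
`s`. -/
noncomputable def laguerreDoubleTerm (a x s : ℝ) (p : ℕ × ℕ) : ℝ :=
  (-(x * s)) ^ p.1 / Nat.factorial p.1 / Real.Gamma (p.1 + a + 1) *
    (Real.Gamma (p.2 + (p.1 + a + 1)) / Nat.factorial p.2 * s ^ p.2)

theorem sum_laguerreDoubleTerm (ha : -1 < a) (x s : ℝ) (n : ℕ) :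
    ∑ j ∈ Finset.range (n + 1), laguerreDoubleTerm a x s (j, n - j) =
      laguerrePoly a n x * s ^ n := by
  rw [laguerrePoly, Finset.sum_mul]
  refine Finset.sum_congr rfl fun j hj => ?_
  obtain ⟨m, rfl⟩ := Nat.exists_eq_add_of_le (Finset.mem_range_succ_iff.1 hj)
  have hGamma := Gamma_natCast_add_add_one_pos ha j
  rw [laguerreDoubleTerm, Nat.add_sub_cancel_left, neg_pow, mul_pow, pow_add,
    show ((j + m : ℕ) : ℝ) + a + 1 = m + (j + a + 1) by push_cast; ring]
  field_simp

theorem hasSum_laguerreDoubleTerm_row (ha : -1 < a) (x : ℝ) {s : ℝ} (hs : |s| < 1) (j : ℕ) :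
    HasSum (fun m => laguerreDoubleTerm a x s (j, m))
      ((1 - s) ^ (-(a + 1)) * ((-(x * s / (1 - s))) ^ j / Nat.factorial j)) := by
  have hs1 : 0 < 1 - s := by linarith [(abs_lt.1 hs).2]
  have hpos := natCast_add_add_one_pos ha j
  have hGamma := (Gamma_natCast_add_add_one_pos ha j).ne'
  have h := (hasSum_Gamma_div_factorial_mul_pow (c := j + a + 1) (fun m => by positivity)
    hs).mul_left ((-(x * s)) ^ j / Nat.factorial j / Real.Gamma (j + a + 1))
  have htotal : (1 - s) ^ (-(a + 1)) * ((-(x * s / (1 - s))) ^ j / Nat.factorial j) =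
      (-(x * s)) ^ j / Nat.factorial j / Real.Gamma (j + a + 1) *
        (Real.Gamma (j + a + 1) * (1 - s) ^ (-((j : ℝ) + a + 1))) := by
    rw [show -((j : ℝ) + a + 1) = -(a + 1) - j by ring, Real.rpow_sub_natCast hs1.ne', ← neg_div,
      div_pow]
    field_simp
  rw [htotal]
  exact h

theorem hasSum_laguerreDoubleTerm_total (a x s : ℝ) :
    HasSum (fun j : ℕ => (1 - s) ^ (-(a + 1)) * ((-(x * s / (1 - s))) ^ j / Nat.factorial j))
      ((1 - s) ^ (-(a + 1)) * Real.exp (-(x * s / (1 - s)))) :=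
  (hasSum_pow_div_factorial _).mul_left _

theorem norm_laguerreDoubleTerm (ha : -1 < a) (x s : ℝ) (p : ℕ × ℕ) :
    ‖laguerreDoubleTerm a x s p‖ = laguerreDoubleTerm a (-|x|) |s| p := by
  have hpos := natCast_add_add_one_pos ha p.1
  have hGamma := Gamma_natCast_add_add_one_pos ha p.1
  have hGamma' : 0 < Real.Gamma (p.2 + (p.1 + a + 1)) := Real.Gamma_pos_of_pos (by positivity)
  simp only [laguerreDoubleTerm, norm_mul, norm_div, norm_pow, Real.norm_eq_abs, abs_neg, abs_mul,
    abs_of_pos hGamma, abs_of_pos hGamma', Nat.abs_cast, neg_mul, neg_neg]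

theorem summable_laguerreDoubleTerm (ha : -1 < a) (x : ℝ) {s : ℝ} (hs : |s| < 1) :
    Summable (laguerreDoubleTerm a x s) := by
  have hrow := hasSum_laguerreDoubleTerm_row ha (-|x|) (s := |s|) (by rwa [abs_abs])
  refine Summable.of_norm ?_
  simp only [norm_laguerreDoubleTerm ha]
  refine (summable_prod_of_nonneg fun p => ?_).2 ⟨fun j => (hrow j).summable, ?_⟩
  · exact norm_laguerreDoubleTerm ha x s p ▸ norm_nonneg _
  · simpa only [(hrow _).tsum_eq] using (hasSum_laguerreDoubleTerm_total a (-|x|) |s|).summable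

theorem hasSum_laguerrePoly_mul_pow (ha : -1 < a) (x : ℝ) {s : ℝ} (hs : |s| < 1) :
    HasSum (fun n => laguerrePoly a n x * s ^ n)
      ((1 - s) ^ (-(a + 1)) * Real.exp (-(x * s / (1 - s)))) := by
  have h := (summable_laguerreDoubleTerm ha x hs).hasSum
  rw [(h.prod_fiberwise (hasSum_laguerreDoubleTerm_row ha x hs)).unique
    (hasSum_laguerreDoubleTerm_total a x s)] at h
  simpa only [sum_laguerreDoubleTerm ha] using hasSum_sum_range_antidiagonal h

/-- Expand the generating function around `r` instead of `0`. -/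
theorem hasSum_laguerrePoly_mul_choose_mul_pow_sub (ha : -1 < a) (x : ℝ) {r : ℝ} (hr : |r| < 1)
    (j : ℕ) :
    HasSum (fun n => laguerrePoly a n x * ((n.choose j : ℝ) * r ^ (n - j)))
      ((1 - r) ^ (-(a + 1)) * Real.exp (-(x * r / (1 - r))) *
        (laguerrePoly a j (x / (1 - r)) / (1 - r) ^ j)) := by
  have hr1 : 0 < 1 - r := by linarith [(abs_lt.1 hr).2]
  refine hasSum_mul_choose_mul_pow_sub (ρ := 1 - |r|) (c := fun n => laguerrePoly a n x)
    (g := fun j => (1 - r) ^ (-(a + 1)) * Real.exp (-(x * r / (1 - r))) *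
      (laguerrePoly a j (x / (1 - r)) / (1 - r) ^ j))
    (F := fun s => (1 - s) ^ (-(a + 1)) * Real.exp (-(x * s / (1 - s)))) (by linarith)
    (fun s hs => hasSum_laguerrePoly_mul_pow ha x (by linarith)) (fun v hv => ?_) j
  have hv' : |v / (1 - r)| < 1 := by
    rw [abs_div, abs_of_pos hr1, div_lt_one hr1]
    linarith [le_abs_self r]
  have hv1 : 0 < 1 - v / (1 - r) := by linarith [(abs_lt.1 hv').2]
  have hfactor : 1 - (r + v) = (1 - r) * (1 - v / (1 - r)) := by field_simp; ring
  have hexponent : -(x * (r + v) / (1 - (r + v))) =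
      -(x * r / (1 - r)) + -(x / (1 - r) * (v / (1 - r)) / (1 - v / (1 - r))) := by
    have hne : 1 - (r + v) ≠ 0 := hfactor ▸ (mul_pos hr1 hv1).ne'
    rw [show 1 - v / (1 - r) = (1 - (r + v)) / (1 - r) by rw [hfactor]; field_simp]
    field_simp
    ring
  have h := (hasSum_laguerrePoly_mul_pow ha (x / (1 - r)) hv').mul_left
    ((1 - r) ^ (-(a + 1)) * Real.exp (-(x * r / (1 - r))))
  rw [mul_mul_mul_comm, ← Real.mul_rpow hr1.le hv1.le, ← Real.exp_add, ← hexponent, ← hfactor] at h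
  refine h.congr_fun fun n => ?_
  rw [div_pow]
  ring

end GeneratingFunction

section HilleHardy

variable {a : ℝ}

theorem summable_pow_div_Gamma (ha : -1 < a) (z : ℝ) :
    Summable fun i : ℕ => z ^ i / Real.Gamma (i + a + 1) := by
  refine summable_of_ratio_norm_eventually_le (r := 1 / 2) (by norm_num) ?_
  have hlarge : ∀ᶠ i : ℕ in atTop, 2 * |z| ≤ (i : ℝ) + a + 1 := by
    filter_upwards [tendsto_natCast_atTop_atTop.eventually_ge_atTop (2 * |z| - a - 1)] with i hi
    linarith
  filter_upwards [hlarge] with i hi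
  have hpos := natCast_add_add_one_pos ha i
  have hGamma_succ : Real.Gamma ((i + 1 : ℕ) + a + 1) =
      (i + a + 1) * Real.Gamma (i + a + 1) := by
    rw [← Real.Gamma_add_one hpos.ne']
    push_cast
    ring_nf
  have hratio : z ^ (i + 1) / ((i + a + 1) * Real.Gamma (i + a + 1)) =
      z / (i + a + 1) * (z ^ i / Real.Gamma (i + a + 1)) := by
    rw [pow_succ', mul_div_mul_comm]
  rw [hGamma_succ, hratio, norm_mul, norm_div z, Real.norm_eq_abs z, Real.norm_of_nonneg hpos.le]
  refine mul_le_mul_of_nonneg_right ?_ (norm_nonneg _)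
  rw [div_le_div_iff₀ hpos two_pos]
  linarith

/-- The entire function `∑ i, z ^ i / (i! Γ(i + a + 1))`, related to the modified Bessel function
by `I_a(2 √z) = z ^ (a / 2) * besselSeries a z`. -/
noncomputable def besselSeries (a z : ℝ) : ℝ :=
  ∑' i : ℕ, z ^ i / Nat.factorial i / Real.Gamma (i + a + 1)

theorem hasSum_besselSeries (ha : -1 < a) (z : ℝ) :
    HasSum (fun i : ℕ => z ^ i / Nat.factorial i / Real.Gamma (i + a + 1)) (besselSeries a z) := by
  refine Summable.hasSum (Summable.of_norm_bounded (summable_pow_div_Gamma ha z).norm fun i => ?_)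
  rw [div_right_comm, norm_div _ (Nat.factorial i : ℝ), RCLike.norm_natCast]
  exact div_le_self (norm_nonneg _) (Nat.one_le_cast.2 i.factorial_pos)

theorem hasSum_pow_div_Gamma_mul_laguerrePoly (ha : -1 < a) (x w : ℝ) :
    HasSum (fun j : ℕ => w ^ j / Real.Gamma (j + a + 1) * laguerrePoly a j x)
      (Real.exp w * besselSeries a (-x * w)) := by
  have hbessel := hasSum_besselSeries ha (-x * w)
  have hexp := hasSum_pow_div_factorial w
  have h := hasSum_sum_range_mul_of_summable_norm hbessel.summable.norm hexp.summable.norm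
  rw [hbessel.tsum_eq, hexp.tsum_eq, mul_comm (besselSeries a _)] at h
  refine h.congr_fun fun n => ?_
  rw [laguerrePoly, Finset.mul_sum]
  refine Finset.sum_congr rfl fun j hj => ?_
  obtain ⟨m, rfl⟩ := Nat.exists_eq_add_of_le (Finset.mem_range_succ_iff.1 hj)
  have hGamma := Gamma_natCast_add_add_one_pos ha j
  have hGamma' := Gamma_natCast_add_add_one_pos ha (j + m)
  rw [Nat.add_sub_cancel_left, mul_pow, neg_pow x, pow_add]
  field_simp

theorem hasSum_choose_mul_pow_div_Gamma (ha : -1 < a) (n : ℕ) (y : ℝ) :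
    HasSum (fun j => (n.choose j : ℝ) * ((-y) ^ j / Real.Gamma (j + a + 1)))
      (Nat.factorial n / Real.Gamma (n + a + 1) * laguerrePoly a n y) := by
  have hvalue : Nat.factorial n / Real.Gamma (n + a + 1) * laguerrePoly a n y =
      ∑ j ∈ Finset.range (n + 1), (n.choose j : ℝ) * ((-y) ^ j / Real.Gamma (j + a + 1)) := by
    rw [laguerrePoly, Finset.mul_sum]
    refine Finset.sum_congr rfl fun j hj => ?_
    have hGamma := Gamma_natCast_add_add_one_pos ha j
    have hGamma' := Gamma_natCast_add_add_one_pos ha n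
    rw [Nat.cast_choose ℝ (Finset.mem_range_succ_iff.1 hj), neg_pow y]
    field_simp
  exact hvalue ▸ hasSum_mul_choose_mul _

theorem summable_laguerrePoly_mul_choose_mul (ha : -1 < a) (x z : ℝ) {r : ℝ} (hr : |r| < 1) :
    Summable fun p : ℕ × ℕ => laguerrePoly a p.1 x *
      ((p.1.choose p.2 : ℝ) * (r ^ (p.1 - p.2) * (z ^ p.2 / Real.Gamma (p.2 + a + 1)))) := by
  obtain ⟨ε, hε, hrε⟩ : ∃ ε > 0, |r| + ε < 1 := ⟨(1 - |r|) / 2, by linarith, by linarith⟩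
  obtain ⟨M, hM⟩ := (summable_pow_div_Gamma ha (z / ε)).norm.tendsto_atTop_zero.bddAbove_range
  have hbound : ∀ j : ℕ, ‖z ^ j / Real.Gamma (j + a + 1)‖ ≤ M * ε ^ j := by
    intro j
    rw [← div_le_iff₀ (by positivity)]
    refine le_trans (le_of_eq ?_) (hM ⟨j, rfl⟩)
    simp only [norm_div, norm_pow, div_pow, Real.norm_of_nonneg hε.le]
    rw [div_right_comm]
  have hsummable : Summable fun n => |laguerrePoly a n x| * (|r| + |ε|) ^ n := by
    have habs : |(|r| + ε)| = |r| + ε := abs_of_nonneg (by positivity)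
    refine (hasSum_laguerrePoly_mul_pow ha x (s := |r| + ε) (by rwa [habs])).summable.norm.congr
      fun n => ?_
    rw [norm_mul, norm_pow, Real.norm_eq_abs, Real.norm_eq_abs, habs, abs_of_pos hε]
  refine Summable.of_norm_bounded
    ((summable_mul_choose_mul_pow_mul_pow hsummable).norm.mul_left M) fun p => ?_
  simp only [norm_mul, norm_pow ε, Real.norm_of_nonneg hε.le]
  calc ‖laguerrePoly a p.1 x‖ * (‖(p.1.choose p.2 : ℝ)‖ *
        (‖r ^ (p.1 - p.2)‖ * ‖z ^ p.2 / Real.Gamma (p.2 + a + 1)‖))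
      ≤ ‖laguerrePoly a p.1 x‖ * (‖(p.1.choose p.2 : ℝ)‖ *
        (‖r ^ (p.1 - p.2)‖ * (M * ε ^ p.2))) := by gcongr; exact hbound p.2
    _ = _ := by ring

/-- The Hille–Hardy formula: expand `L_n^a(y)` in powers of `y` and sum over `n` first. -/
theorem hasSum_laguerrePoly_mul_laguerrePoly (ha : -1 < a) (x y : ℝ) {r : ℝ} (hr : |r| < 1) :
    HasSum (fun n => r ^ n * laguerrePoly a n x *
      (Nat.factorial n / Real.Gamma (n + a + 1) * laguerrePoly a n y))
      ((1 - r) ^ (-(a + 1)) * Real.exp (-(x * r / (1 - r))) * Real.exp (-(y * r / (1 - r))) *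
        besselSeries a (x * y * r / (1 - r) ^ 2)) := by
  have hr1 : 1 - r ≠ 0 := by linarith [(abs_lt.1 hr).2]
  have hpow : ∀ n j : ℕ, (n.choose j : ℝ) * (r ^ (n - j) * ((-(y * r)) ^ j)) =
      r ^ n * ((n.choose j : ℝ) * (-y) ^ j) := by
    intro n j
    rcases le_or_gt j n with hj | hj
    · obtain ⟨m, rfl⟩ := Nat.exists_eq_add_of_le hj
      rw [Nat.add_sub_cancel_left, neg_mul_eq_neg_mul, mul_pow, pow_add]
      ring
    · simp [Nat.choose_eq_zero_of_lt hj]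
  have hsum := (summable_laguerrePoly_mul_choose_mul ha x (-(y * r)) hr).hasSum
  have hrow := hsum.prod_fiberwise fun n =>
    ((hasSum_choose_mul_pow_div_Gamma ha n y).mul_left (r ^ n * laguerrePoly a n x)).congr_fun
      fun j => by linear_combination (laguerrePoly a n x / Real.Gamma (j + a + 1)) * hpow n j
  have hcolumn := ((Equiv.prodComm ℕ ℕ).hasSum_iff.2 hsum).prod_fiberwise fun j =>
    ((hasSum_laguerrePoly_mul_choose_mul_pow_sub ha x hr j).mul_right
      ((-(y * r)) ^ j / Real.Gamma (j + a + 1))).congr_fun fun n => by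
        simp only [Function.comp, Equiv.prodComm_apply, Prod.swap_prod_mk]
        ring
  have hbessel := (hasSum_pow_div_Gamma_mul_laguerrePoly ha (x / (1 - r))
    (-(y * r / (1 - r)))).mul_left ((1 - r) ^ (-(a + 1)) * Real.exp (-(x * r / (1 - r))))
  rw [hcolumn.unique (hbessel.congr_fun fun j => by
    rw [show -(y * r / (1 - r)) = -(y * r) / (1 - r) by ring, div_pow]
    ring)] at hrow
  rwa [← mul_assoc, show -(x / (1 - r)) * -(y * r / (1 - r)) = x * y * r / (1 - r) ^ 2 by
    field_simp] at hrow

end HilleHardy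

/-! ### The one-dimensional heat kernel -/

section IncompleteGamma

theorem intervalIntegrable_exp_neg_mul_rpow {s z : ℝ} (hs : 0 < s) (hz : 0 ≤ z) :
    IntervalIntegrable (fun u : ℝ => Real.exp (-u) * u ^ (s - 1)) volume 0 z := by
  rw [intervalIntegrable_iff_integrableOn_Ioc_of_le hz]
  exact (Real.GammaIntegral_convergent hs).mono_set Set.Ioc_subset_Ioi_self

/-- The regularized lower incomplete Gamma function `P(s, z)`, for `s > 0` and `z ≥ 0`. -/
noncomputable def regularizedLowerGamma (s z : ℝ) : ℝ :=
  (∫ u in (0 : ℝ)..z, Real.exp (-u) * u ^ (s - 1)) / Real.Gamma s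

theorem regularizedLowerGamma_nonneg {s z : ℝ} (hs : 0 < s) (hz : 0 ≤ z) :
    0 ≤ regularizedLowerGamma s z :=
  div_nonneg (intervalIntegral.integral_nonneg hz fun _ hu =>
    mul_nonneg (Real.exp_pos _).le (Real.rpow_nonneg hu.1 _)) (Real.Gamma_pos_of_pos hs).le

theorem regularizedLowerGamma_le_one {s z : ℝ} (hs : 0 < s) (hz : 0 ≤ z) :
    regularizedLowerGamma s z ≤ 1 := by
  rw [regularizedLowerGamma, div_le_one (Real.Gamma_pos_of_pos hs), Real.Gamma_eq_integral hs,
    intervalIntegral.integral_of_le hz]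
  refine setIntegral_mono_set (Real.GammaIntegral_convergent hs) ?_
    Set.Ioc_subset_Ioi_self.eventuallyLE
  filter_upwards [ae_restrict_mem measurableSet_Ioi] with u hu
  exact mul_nonneg (Real.exp_pos _).le (Real.rpow_nonneg (Set.mem_Ioi.1 hu).le _)

theorem intervalIntegral_exp_neg_mul_rpow {s z : ℝ} (hs : 0 < s) (hz : 0 ≤ z) :
    ∫ u in (0 : ℝ)..z, Real.exp (-u) * u ^ (s + 1 - 1) =
      s * (∫ u in (0 : ℝ)..z, Real.exp (-u) * u ^ (s - 1)) - z ^ s * Real.exp (-z) := by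
  have hint := (intervalIntegrable_exp_neg_mul_rpow hs hz).const_mul s
  have hint_succ := intervalIntegrable_exp_neg_mul_rpow (add_pos hs one_pos) hz
  have hderiv : ∀ u ∈ Set.Ioo 0 z, HasDerivAt (fun u : ℝ => u ^ s * Real.exp (-u))
      (s * (Real.exp (-u) * u ^ (s - 1)) - Real.exp (-u) * u ^ (s + 1 - 1)) u := fun u hu => by
    refine ((Real.hasDerivAt_rpow_const (Or.inl hu.1.ne')).mul (hasDerivAt_neg u).exp).congr_deriv
      ?_
    rw [add_sub_cancel_right]
    ring
  have hcont : Continuous fun u : ℝ => u ^ s * Real.exp (-u) :=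
    (Real.continuous_rpow_const hs.le).mul (by fun_prop)
  have hFTC := intervalIntegral.integral_eq_sub_of_hasDerivAt_of_le hz hcont.continuousOn hderiv
    (hint.sub hint_succ)
  rw [intervalIntegral.integral_sub hint hint_succ, intervalIntegral.integral_const_mul,
    Real.zero_rpow hs.ne'] at hFTC
  linarith

theorem rpow_div_Gamma_eq_sub {s z : ℝ} (hs : 0 < s) (hz : 0 ≤ z) :
    z ^ s / Real.Gamma (s + 1) =
      Real.exp z * (regularizedLowerGamma s z - regularizedLowerGamma (s + 1) z) := by
  have := Real.Gamma_pos_of_pos hs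
  have := Real.exp_pos z
  rw [regularizedLowerGamma, regularizedLowerGamma, intervalIntegral_exp_neg_mul_rpow hs hz,
    Real.Gamma_add_one hs.ne', Real.exp_neg]
  field_simp
  ring

theorem sum_rpow_div_Gamma_le_exp {b z : ℝ} (hb : 0 ≤ b) (hz : 0 ≤ z) (N : ℕ) :
    ∑ m ∈ Finset.range N, z ^ (m + b) / Real.Gamma (m + b + 1) ≤ Real.exp z := by
  rcases hb.eq_or_lt with rfl | hb
  · simpa [Real.Gamma_nat_eq_factorial] using Real.sum_le_exp_of_nonneg hz N
  have hpos : ∀ m : ℕ, 0 < (m : ℝ) + b := fun m => by positivity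
  set P : ℕ → ℝ := fun m => regularizedLowerGamma (m + b) z with hP
  have htelescope : ∀ m : ℕ,
      z ^ (m + b) / Real.Gamma (m + b + 1) = Real.exp z * (P m - P (m + 1)) := fun m => by
    rw [rpow_div_Gamma_eq_sub (hpos m) hz, hP]
    simp only [Nat.cast_succ, add_right_comm]
  rw [Finset.sum_congr rfl fun m _ => htelescope m, ← Finset.mul_sum, Finset.sum_range_sub']
  refine mul_le_of_le_one_right (Real.exp_pos z).le ?_
  linarith [regularizedLowerGamma_le_one (hpos 0) hz, regularizedLowerGamma_nonneg (hpos N) hz]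

end IncompleteGamma

section BesselEstimates

variable {a : ℝ}

theorem besselSeries_nonneg (ha : -1 < a) {z : ℝ} (hz : 0 ≤ z) : 0 ≤ besselSeries a z :=
  tsum_nonneg fun i => by
    have := Gamma_natCast_add_add_one_pos ha i
    positivity

theorem measurable_besselSeries (ha : -1 < a) : Measurable (besselSeries a) :=
  measurable_of_tendsto_metrizable
    (f := fun N z => ∑ i ∈ Finset.range N, z ^ i / Nat.factorial i / Real.Gamma (i + a + 1))
    (fun N => by fun_prop)
    (tendsto_pi_nhds.2 fun z => (hasSum_besselSeries ha z).tendsto_sum_nat)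

theorem Gamma_sq_le_factorial_mul_Gamma (ha : 0 ≤ a) (m : ℕ) :
    Real.Gamma (m + a / 2 + 1) ^ 2 ≤ Nat.factorial m * Real.Gamma (m + a + 1) := by
  have hlogconvex := Real.Gamma_mul_add_mul_le_rpow_Gamma_mul_rpow_Gamma (s := m + 1)
    (t := m + a + 1) (a := 1 / 2) (b := 1 / 2) (by positivity) (by positivity) (by norm_num)
    (by norm_num) (by norm_num)
  have hGamma : ∀ b : ℝ, 0 ≤ b → 0 ≤ Real.Gamma ((m : ℝ) + b + 1) := fun b hb =>
    (Gamma_natCast_add_add_one_pos (by linarith) m).le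
  rw [← Real.sqrt_eq_rpow, ← Real.sqrt_eq_rpow,
    show 1 / 2 * ((m : ℝ) + 1) + 1 / 2 * (m + a + 1) = m + a / 2 + 1 by ring,
    Real.Gamma_nat_eq_factorial, ← Real.sqrt_mul (by positivity)] at hlogconvex
  exact (Real.le_sqrt (hGamma _ (by positivity))
    (mul_nonneg (by positivity) (hGamma a ha))).1 hlogconvex

theorem rpow_mul_besselSeries_term_le (ha : 0 ≤ a) {z : ℝ} (hz : 0 < z) (m : ℕ) :
    (z ^ 2) ^ (a / 2) * ((z ^ 2) ^ m / Nat.factorial m / Real.Gamma (m + a + 1)) ≤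
      (z ^ (m + a / 2) / Real.Gamma (m + a / 2 + 1)) ^ 2 := by
  have : 0 < Real.Gamma (m + a / 2 + 1) := Gamma_natCast_add_add_one_pos (by linarith) m
  have hpow : (z ^ 2) ^ (a / 2) * (z ^ 2) ^ m = (z ^ (m + a / 2)) ^ 2 := by
    rw [← Real.rpow_natCast (z ^ 2), ← Real.rpow_add (by positivity), Real.rpow_pow_comm hz.le,
      add_comm]
  rw [div_div, ← mul_div_assoc, hpow, div_pow]
  gcongr
  exact Gamma_sq_le_factorial_mul_Gamma ha m

theorem rpow_mul_besselSeries_le (ha : 0 ≤ a) {z : ℝ} (hz : 0 < z) :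
    (z ^ 2) ^ (a / 2) * besselSeries a (z ^ 2) ≤ Real.exp (2 * z) := by
  have hGamma : ∀ b : ℝ, 0 ≤ b → ∀ m : ℕ, 0 < Real.Gamma (m + b + 1) := fun b hb =>
    Gamma_natCast_add_add_one_pos (by linarith)
  have hnonneg : ∀ m : ℕ, 0 ≤ z ^ (m + a / 2) / Real.Gamma (m + a / 2 + 1) := fun m =>
    div_nonneg (by positivity) (hGamma _ (by positivity) m).le
  rw [besselSeries, ← tsum_mul_left]
  refine Real.tsum_le_of_sum_range_le (fun m => ?_) fun N => ?_
  · have := hGamma a ha m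
    positivity
  calc ∑ m ∈ Finset.range N,
        (z ^ 2) ^ (a / 2) * ((z ^ 2) ^ m / Nat.factorial m / Real.Gamma (m + a + 1))
      ≤ ∑ m ∈ Finset.range N, (z ^ (m + a / 2) / Real.Gamma (m + a / 2 + 1)) ^ 2 :=
        Finset.sum_le_sum fun m _ => rpow_mul_besselSeries_term_le ha hz m
    _ ≤ (∑ m ∈ Finset.range N, z ^ (m + a / 2) / Real.Gamma (m + a / 2 + 1)) ^ 2 :=
        Finset.sum_sq_le_sq_sum_of_nonneg fun m _ => hnonneg m
    _ ≤ Real.exp z ^ 2 := pow_le_pow_left₀ (Finset.sum_nonneg fun m _ => hnonneg m)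
        (sum_rpow_div_Gamma_le_exp (by positivity) hz.le N) 2
    _ = Real.exp (2 * z) := by rw [← Real.exp_nat_mul, Nat.cast_two]

theorem lintegral_rpow_mul_exp_neg_mul {s c : ℝ} (hs : 0 < s) (hc : 0 < c) :
    ∫⁻ y in Set.Ioi (0 : ℝ), ENNReal.ofReal (y ^ (s - 1) * Real.exp (-(c * y))) =
      ENNReal.ofReal ((1 / c) ^ s * Real.Gamma s) := by
  have hpos : 0 < (1 / c) ^ s * Real.Gamma s :=
    mul_pos (by positivity) (Real.Gamma_pos_of_pos hs)
  rw [← Real.integral_rpow_mul_exp_neg_mul_Ioi hs hc] at hpos ⊢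
  refine (ofReal_integral_eq_lintegral_ofReal
    (not_imp_comm.1 integral_undef hpos.ne') ?_).symm
  filter_upwards [ae_restrict_mem measurableSet_Ioi] with u hu
  exact mul_nonneg (Real.rpow_nonneg (Set.mem_Ioi.1 hu).le _) (Real.exp_pos _).le

theorem lintegral_besselSeries_term_le (ha : 0 ≤ a) {v c : ℝ} (hv : 0 < v) (hc : 0 < c) (m : ℕ) :
    ∫⁻ y in Set.Ioi (0 : ℝ), ENNReal.ofReal ((v * y) ^ (m + a / 2) /
        (Nat.factorial m * Real.Gamma (m + a + 1)) * Real.exp (-(c * y))) ≤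
      ENNReal.ofReal (c⁻¹ * ((v / c) ^ (m + a / 2) / Real.Gamma (m + a / 2 + 1))) := by
  have := Gamma_natCast_add_add_one_pos (by linarith : -1 < a) m
  have hGamma_half := Gamma_natCast_add_add_one_pos (by linarith : -1 < a / 2) m
  set K := v ^ (m + a / 2) / (Nat.factorial m * Real.Gamma (m + a + 1)) with hK
  have hK0 : 0 ≤ K := by positivity
  have hterm : ∀ y ∈ Set.Ioi (0 : ℝ), ENNReal.ofReal ((v * y) ^ (m + a / 2) /
      (Nat.factorial m * Real.Gamma (m + a + 1)) * Real.exp (-(c * y))) =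
      ENNReal.ofReal K * ENNReal.ofReal (y ^ (m + a / 2 + 1 - 1) * Real.exp (-(c * y))) := by
    intro y hy
    rw [← ENNReal.ofReal_mul hK0, Real.mul_rpow hv.le (Set.mem_Ioi.1 hy).le, add_sub_cancel_right,
      hK]
    ring_nf
  have hratio : Real.Gamma (m + a / 2 + 1) / (Nat.factorial m * Real.Gamma (m + a + 1)) ≤
      1 / Real.Gamma (m + a / 2 + 1) := by
    rw [div_le_div_iff₀ (by positivity) hGamma_half, ← sq, one_mul]
    exact Gamma_sq_le_factorial_mul_Gamma ha m
  rw [setLIntegral_congr_fun measurableSet_Ioi hterm, lintegral_const_mul _ (by fun_prop),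
    lintegral_rpow_mul_exp_neg_mul (by positivity) hc, ← ENNReal.ofReal_mul hK0]
  refine ENNReal.ofReal_le_ofReal ?_
  calc K * ((1 / c) ^ (m + a / 2 + 1) * Real.Gamma (m + a / 2 + 1))
      = c⁻¹ * ((v / c) ^ (m + a / 2) *
          (Real.Gamma (m + a / 2 + 1) / (Nat.factorial m * Real.Gamma (m + a + 1)))) := by
        rw [Real.rpow_add_one (by positivity), div_eq_mul_one_div v c,
          Real.mul_rpow hv.le (by positivity), hK]
        ring
    _ ≤ c⁻¹ * ((v / c) ^ (m + a / 2) * (1 / Real.Gamma (m + a / 2 + 1))) := by gcongr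
    _ = c⁻¹ * ((v / c) ^ (m + a / 2) / Real.Gamma (m + a / 2 + 1)) := by ring

theorem hasSum_rpow_mul_besselSeries_mul_exp (ha : -1 < a) {u : ℝ} (hu : 0 < u) (v : ℝ) :
    HasSum (fun m : ℕ => u ^ (m + a / 2) / (Nat.factorial m * Real.Gamma (m + a + 1)) * Real.exp v)
      (u ^ (a / 2) * besselSeries a u * Real.exp v) :=
  (((hasSum_besselSeries ha u).mul_left (u ^ (a / 2))).mul_right (Real.exp v)).congr_fun fun m => by
    rw [Real.rpow_add hu, Real.rpow_natCast]
    ring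

theorem lintegral_rpow_mul_besselSeries_mul_exp_neg_le (ha : 0 ≤ a) {v c : ℝ} (hv : 0 < v)
    (hc : 0 < c) :
    ∫⁻ y in Set.Ioi (0 : ℝ), ENNReal.ofReal ((v * y) ^ (a / 2) * besselSeries a (v * y) *
      Real.exp (-(c * y))) ≤ ENNReal.ofReal (c⁻¹ * Real.exp (v / c)) := by
  have hGamma : ∀ b : ℝ, 0 ≤ b → ∀ m : ℕ, 0 < Real.Gamma (m + b + 1) := fun b hb =>
    Gamma_natCast_add_add_one_pos (by linarith)
  set F : ℕ → ℝ → ℝ := fun m y => (v * y) ^ (m + a / 2) /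
    (Nat.factorial m * Real.Gamma (m + a + 1)) * Real.exp (-(c * y))
  have hF0 : ∀ m y, 0 < y → 0 ≤ F m y := fun m y hy => by
    have := hGamma a ha m
    positivity
  calc _ = ∫⁻ y in Set.Ioi (0 : ℝ), ∑' m, ENNReal.ofReal (F m y) := by
        refine setLIntegral_congr_fun measurableSet_Ioi fun y hy => ?_
        have hsum := hasSum_rpow_mul_besselSeries_mul_exp (by linarith : -1 < a)
          (mul_pos hv hy) (-(c * y))
        rw [← ENNReal.ofReal_tsum_of_nonneg (fun m => hF0 m y hy) hsum.summable, hsum.tsum_eq]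
    _ = ∑' m, ∫⁻ y in Set.Ioi (0 : ℝ), ENNReal.ofReal (F m y) :=
        lintegral_tsum fun m => by fun_prop
    _ ≤ ∑' m : ℕ, ENNReal.ofReal (c⁻¹ * ((v / c) ^ (m + a / 2) / Real.Gamma (m + a / 2 + 1))) :=
        ENNReal.tsum_le_tsum fun m => lintegral_besselSeries_term_le ha hv hc m
    _ ≤ ENNReal.ofReal (c⁻¹ * Real.exp (v / c)) := by
        refine ENNReal.tsum_le_of_sum_range_le fun N => ?_
        rw [← ENNReal.ofReal_sum_of_nonneg fun m _ => mul_nonneg (inv_nonneg.2 hc.le)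
          (div_nonneg (by positivity) (hGamma _ (by positivity) m).le), ← Finset.mul_sum]
        gcongr
        exact sum_rpow_div_Gamma_le_exp (by positivity) (by positivity) N

end BesselEstimates

section HeatKernel

variable {a t x y : ℝ}

/-- The one-dimensional Laguerre heat kernel, in the closed form given by the Hille–Hardy
formula. -/
noncomputable def laguerreHeat (a t x y : ℝ) : ℝ :=
  (2 * Real.sinh (t / 2))⁻¹ *
    (((2 * Real.sinh (t / 2))⁻¹ ^ 2 * (x * y)) ^ (a / 2) *
      besselSeries a ((2 * Real.sinh (t / 2))⁻¹ ^ 2 * (x * y))) *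
    Real.exp (-(Real.cosh (t / 2) / Real.sinh (t / 2)) * (x + y) / 2)

theorem exp_mul_laguerreFun1_mul_laguerreFun1 (ha : -1 < a) (t : ℝ) (hx : 0 < x) (hy : 0 < y)
    (k : ℕ) :
    Real.exp (-t * (k + (a + 1) / 2)) * laguerreFun1 a k x * laguerreFun1 a k y =
      Real.exp (-t * ((a + 1) / 2)) * ((x * y) ^ (a / 2) * Real.exp (-(x + y) / 2)) *
      (Real.exp (-t) ^ k * laguerrePoly a k x *
        (Nat.factorial k / Real.Gamma (k + a + 1) * laguerrePoly a k y)) := by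
  have hexp : Real.exp (-t * (k + (a + 1) / 2)) =
      Real.exp (-t) ^ k * Real.exp (-t * ((a + 1) / 2)) := by
    rw [← Real.exp_nat_mul, ← Real.exp_add]
    ring_nf
  have hnorm : Nat.factorial k / Real.Gamma (k + a + 1) =
      √(Real.Gamma (k + 1) / Real.Gamma (k + a + 1)) *
        √(Real.Gamma (k + 1) / Real.Gamma (k + a + 1)) := by
    have := Gamma_natCast_add_add_one_pos ha k
    rw [Real.Gamma_nat_eq_factorial, Real.mul_self_sqrt (by positivity)]
  rw [hexp, hnorm, Real.mul_rpow hx.le hy.le, neg_add x, add_div (-x), Real.exp_add (-x / 2),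
    laguerreFun1, laguerreFun1]
  ring

theorem two_mul_sinh_half (t : ℝ) :
    2 * Real.sinh (t / 2) = (1 - Real.exp (-t)) / Real.exp (-(t / 2)) := by
  rw [Real.sinh_eq, sub_div 1, one_div, ← Real.exp_neg, neg_neg, ← Real.exp_sub]
  ring_nf

theorem two_mul_cosh_half (t : ℝ) :
    2 * Real.cosh (t / 2) = (1 + Real.exp (-t)) / Real.exp (-(t / 2)) := by
  rw [Real.cosh_eq, add_div 1, one_div, ← Real.exp_neg, neg_neg, ← Real.exp_sub]
  ring_nf

theorem cosh_half_div_sinh_half (t : ℝ) :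
    Real.cosh (t / 2) / Real.sinh (t / 2) = (1 + Real.exp (-t)) / (1 - Real.exp (-t)) := by
  rw [← mul_div_mul_left _ _ two_ne_zero, two_mul_sinh_half, two_mul_cosh_half,
    div_div_div_cancel_right₀ (Real.exp_pos _).ne']

theorem exp_neg_cosh_half_div_sinh_half_mul (ht : 0 < t) (x y : ℝ) :
    Real.exp (-(Real.cosh (t / 2) / Real.sinh (t / 2)) * (x + y) / 2) =
      Real.exp (-(x + y) / 2) * (Real.exp (-(x * Real.exp (-t) / (1 - Real.exp (-t)))) *
        Real.exp (-(y * Real.exp (-t) / (1 - Real.exp (-t))))) := by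
  have : 0 < 1 - Real.exp (-t) := sub_pos.2 (Real.exp_lt_one_iff.2 (by linarith))
  rw [← Real.exp_add, ← Real.exp_add, cosh_half_div_sinh_half]
  congr 1
  field_simp
  ring

theorem laguerreHeat_eq (ht : 0 < t) (hx : 0 < x) (hy : 0 < y) :
    laguerreHeat a t x y = Real.exp (-t * ((a + 1) / 2)) *
      ((x * y) ^ (a / 2) * Real.exp (-(x + y) / 2)) *
      ((1 - Real.exp (-t)) ^ (-(a + 1)) * Real.exp (-(x * Real.exp (-t) / (1 - Real.exp (-t)))) *
        Real.exp (-(y * Real.exp (-t) / (1 - Real.exp (-t)))) *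
        besselSeries a (x * y * Real.exp (-t) / (1 - Real.exp (-t)) ^ 2)) := by
  set w := (2 * Real.sinh (t / 2))⁻¹ with hw
  have hr : 0 < 1 - Real.exp (-t) := sub_pos.2 (Real.exp_lt_one_iff.2 (by linarith))
  have hw_eq : w = Real.exp (-(t / 2)) / (1 - Real.exp (-t)) := by
    rw [hw, two_mul_sinh_half, inv_div]
  have hw0 : 0 < w := hw_eq ▸ div_pos (Real.exp_pos _) hr
  have harg : w ^ 2 * (x * y) = x * y * Real.exp (-t) / (1 - Real.exp (-t)) ^ 2 := by
    rw [hw_eq, div_pow, ← Real.exp_nat_mul]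
    ring_nf
  have hprefactor : w * (w ^ 2 * (x * y)) ^ (a / 2) = Real.exp (-t * ((a + 1) / 2)) *
      (x * y) ^ (a / 2) * (1 - Real.exp (-t)) ^ (-(a + 1)) := by
    calc w * (w ^ 2 * (x * y)) ^ (a / 2) = w ^ (a + 1) * (x * y) ^ (a / 2) := by
          rw [Real.mul_rpow (by positivity) (by positivity), ← Real.rpow_natCast_mul hw0.le,
            Nat.cast_two, mul_div_cancel₀ a two_ne_zero, Real.rpow_add_one hw0.ne']
          ring
      _ = _ := by
          rw [hw_eq, Real.div_rpow (Real.exp_pos _).le hr.le, ← Real.exp_mul, Real.rpow_neg hr.le]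
          ring_nf
  rw [laguerreHeat, ← hw, ← mul_assoc w, hprefactor, harg,
    exp_neg_cosh_half_div_sinh_half_mul ht]
  ring

theorem hasSum_laguerreHeat (ha : -1 < a) (ht : 0 < t) (hx : 0 < x) (hy : 0 < y) :
    HasSum (fun k : ℕ =>
      Real.exp (-t * (k + (a + 1) / 2)) * laguerreFun1 a k x * laguerreFun1 a k y)
      (laguerreHeat a t x y) := by
  have hr : |Real.exp (-t)| < 1 := by
    rw [abs_of_pos (Real.exp_pos _)]
    exact Real.exp_lt_one_iff.2 (by linarith)
  rw [laguerreHeat_eq ht hx hy]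
  simp only [exp_mul_laguerreFun1_mul_laguerreFun1 ha t hx hy]
  exact (hasSum_laguerrePoly_mul_laguerrePoly ha x y hr).mul_left _

theorem laguerreHeat_comm (a t x y : ℝ) : laguerreHeat a t x y = laguerreHeat a t y x := by
  simp only [laguerreHeat, mul_comm x y, add_comm x y]

theorem laguerreHeat_nonneg (ha : -1 < a) (ht : 0 < t) (hx : 0 < x) (hy : 0 < y) :
    0 ≤ laguerreHeat a t x y := by
  have : 0 < Real.sinh (t / 2) := Real.sinh_pos_iff.2 (by positivity)
  have := besselSeries_nonneg ha
    (show 0 ≤ (2 * Real.sinh (t / 2))⁻¹ ^ 2 * (x * y) by positivity)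
  unfold laguerreHeat
  positivity

theorem measurable_laguerreHeat (ha : -1 < a) (t : ℝ) :
    Measurable fun p : ℝ × ℝ => laguerreHeat a t p.1 p.2 := by
  have := measurable_besselSeries ha
  unfold laguerreHeat
  fun_prop

theorem laguerreHeat_le (ha : 0 ≤ a) (ht : 0 < t) (hx : 0 < x) (hy : 0 < y) :
    laguerreHeat a t x y ≤ (2 * Real.sinh (t / 2))⁻¹ := by
  have hsinh : 0 < Real.sinh (t / 2) := Real.sinh_pos_iff.2 (by positivity)
  have hbessel := rpow_mul_besselSeries_le ha
    (show 0 < (2 * Real.sinh (t / 2))⁻¹ * √(x * y) by positivity)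
  rw [mul_pow, Real.sq_sqrt (by positivity)] at hbessel
  have hamgm : √(x * y) ≤ (x + y) / 2 := by
    rw [Real.sqrt_le_left (by positivity)]
    nlinarith [sq_nonneg (x - y)]
  have hcosh : (x + y) / 2 ≤ Real.cosh (t / 2) * ((x + y) / 2) :=
    le_mul_of_one_le_left (by positivity) (Real.one_le_cosh _)
  have hexponent : 2 * ((2 * Real.sinh (t / 2))⁻¹ * √(x * y)) +
      -(Real.cosh (t / 2) / Real.sinh (t / 2)) * (x + y) / 2 =
      (√(x * y) - Real.cosh (t / 2) * ((x + y) / 2)) / Real.sinh (t / 2) := by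
    field_simp
    ring
  rw [laguerreHeat, mul_assoc]
  refine mul_le_of_le_one_right (by positivity)
    ((mul_le_mul_of_nonneg_right hbessel (Real.exp_pos _).le).trans ?_)
  rw [← Real.exp_add, Real.exp_le_one_iff, hexponent]
  exact div_nonpos_of_nonpos_of_nonneg (by linarith) hsinh.le

theorem lintegral_laguerreHeat_le (ha : 0 ≤ a) (ht : 0 < t) (hx : 0 < x) :
    ∫⁻ y in Set.Ioi (0 : ℝ), ENNReal.ofReal (laguerreHeat a t x y) ≤
      ENNReal.ofReal (Real.cosh (t / 2))⁻¹ := by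
  set S := Real.sinh (t / 2) with hS
  set C := Real.cosh (t / 2) with hC
  have hS0 : 0 < S := Real.sinh_pos_iff.2 (by positivity)
  have hC0 : 0 < C := Real.cosh_pos _
  set K := (2 * S)⁻¹ * Real.exp (-(C / S * x / 2)) with hK
  have hK0 : 0 ≤ K := by positivity
  have hfactor : ∀ y, laguerreHeat a t x y = K * (((2 * S)⁻¹ ^ 2 * x * y) ^ (a / 2) *
      besselSeries a ((2 * S)⁻¹ ^ 2 * x * y) * Real.exp (-(C / (2 * S) * y))) := fun y => by
    have hexp : Real.exp (-(C / S) * (x + y) / 2) =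
        Real.exp (-(C / S * x / 2)) * Real.exp (-(C / (2 * S) * y)) := by
      rw [← Real.exp_add]
      congr 1
      field_simp
      ring
    rw [laguerreHeat, hexp, ← hS, mul_assoc _ x y, hK]
    ring
  have hexponent : -(C / S * x / 2) + (2 * S)⁻¹ ^ 2 * x / (C / (2 * S)) = -(S * x / (2 * C)) := by
    field_simp
    rw [hC, Real.cosh_sq, ← hS]
    ring
  calc ∫⁻ y in Set.Ioi (0 : ℝ), ENNReal.ofReal (laguerreHeat a t x y)
      ≤ ENNReal.ofReal K * ENNReal.ofReal ((C / (2 * S))⁻¹ *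
          Real.exp ((2 * S)⁻¹ ^ 2 * x / (C / (2 * S)))) := by
        simp only [hfactor, ENNReal.ofReal_mul hK0]
        rw [lintegral_const_mul' _ _ ENNReal.ofReal_ne_top]
        gcongr
        exact lintegral_rpow_mul_besselSeries_mul_exp_neg_le ha (by positivity) (by positivity)
    _ = ENNReal.ofReal (C⁻¹ * Real.exp (-(S * x / (2 * C)))) := by
        rw [← ENNReal.ofReal_mul hK0, ← hexponent, Real.exp_add, hK]
        congr 1
        field_simp
    _ ≤ ENNReal.ofReal C⁻¹ := by
        refine ENNReal.ofReal_le_ofReal (mul_le_of_le_one_right (by positivity) ?_)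
        rw [Real.exp_le_one_iff, neg_nonpos]
        positivity

end HeatKernel

/-! ### The Laguerre functions and the heat kernel in several variables -/

section Orthant

theorem orthant_eq_pi (d : ℕ) : orthant d = Set.univ.pi fun _ => Set.Ioi (0 : ℝ) := by
  ext x
  simp [orthant]

theorem isOpen_orthant (d : ℕ) : IsOpen (orthant d) := by
  rw [orthant_eq_pi]
  exact isOpen_set_pi Set.finite_univ fun _ _ => isOpen_Ioi

theorem orthantMeasure_eq_pi (d : ℕ) :
    orthantMeasure d = Measure.pi fun _ => volume.restrict (Set.Ioi (0 : ℝ)) := by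
  rw [orthantMeasure, orthant_eq_pi, volume_pi, Measure.restrict_pi_pi]

instance (d : ℕ) : SigmaFinite (orthantMeasure d) :=
  inferInstanceAs (SigmaFinite (volume.restrict (orthant d)))

theorem ae_mem_orthant (d : ℕ) : ∀ᵐ x ∂orthantMeasure d, x ∈ orthant d :=
  ae_restrict_mem (isOpen_orthant d).measurableSet

instance (d : ℕ) : NeZero (orthantMeasure d) :=
  ⟨fun h => ((isOpen_orthant d).measure_pos volume ⟨1, fun _ => one_pos⟩).ne'
    (Measure.restrict_eq_zero.1 h)⟩

end Orthant

section LaguerreFunctions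

variable {d : ℕ} {α : Fin d → ℝ} {𝕜 : Type*} [RCLike 𝕜]

theorem measurable_laguerreFun (α : Fin d → ℝ) (k : Fin d → ℕ) : Measurable (laguerreFun α k) :=
  Finset.measurable_fun_prod _ fun i _ =>
    (measurable_laguerreFun1 (α i) (k i)).comp (measurable_pi_apply i)

theorem integrable_laguerreFun_mul (hα : ∀ i, -1 < α i) (k l : Fin d → ℕ) :
    Integrable (fun x => laguerreFun α k x * laguerreFun α l x) (orthantMeasure d) := by
  rw [orthantMeasure_eq_pi]
  simp only [laguerreFun, ← Finset.prod_mul_distrib]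
  exact Integrable.fintype_prod
    (f := fun i y => laguerreFun1 (α i) (k i) y * laguerreFun1 (α i) (l i) y)
    fun i => integrableOn_laguerreFun1_mul (hα i) (k i) (l i)

theorem integral_laguerreFun_mul (hα : ∀ i, -1 < α i) (k l : Fin d → ℕ) :
    ∫ x, laguerreFun α k x * laguerreFun α l x ∂orthantMeasure d = if k = l then 1 else 0 := by
  rw [orthantMeasure_eq_pi]
  simp only [laguerreFun, ← Finset.prod_mul_distrib]
  rw [integral_fintype_prod_eq_prod
    (f := fun i y => laguerreFun1 (α i) (k i) y * laguerreFun1 (α i) (l i) y)]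
  simp only [integral_laguerreFun1_mul (hα _)]
  split_ifs with hkl
  · simp [hkl]
  · obtain ⟨i, hi⟩ := Function.ne_iff.1 hkl
    exact Finset.prod_eq_zero (Finset.mem_univ i) (if_neg hi)

theorem memLp_laguerreFun (hα : ∀ i, -1 < α i) (k : Fin d → ℕ) :
    MemLp (fun x => (laguerreFun α k x : 𝕜)) 2 (orthantMeasure d) := by
  have hmeas : Measurable fun x => (laguerreFun α k x : 𝕜) :=
    RCLike.measurable_ofReal.comp (measurable_laguerreFun α k)
  rw [memLp_two_iff_integrable_sq_norm hmeas.aestronglyMeasurable]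
  simpa [sq] using integrable_laguerreFun_mul hα k k

theorem integral_norm_laguerreFun_mul_le (hα : ∀ i, -1 < α i) (k : Fin d → ℕ)
    {f : (Fin d → ℝ) → 𝕜} (hf : MemLp f 2 (orthantMeasure d)) :
    ∫ y, ‖(laguerreFun α k y : 𝕜) * f y‖ ∂orthantMeasure d ≤
      1 + ∫ y, ‖f y‖ ^ 2 ∂orthantMeasure d := by
  have hint := integrable_laguerreFun_mul hα k k
  have hint_f := (memLp_two_iff_integrable_sq_norm hf.1).1 hf
  have hnorm := integral_laguerreFun_mul hα k k
  rw [if_pos rfl] at hnorm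
  rw [← hnorm, ← integral_add hint hint_f]
  refine integral_mono ((memLp_laguerreFun hα k).integrable_mul hf).norm (hint.add hint_f)
    fun y => ?_
  simp only [norm_mul, RCLike.norm_ofReal]
  rw [← abs_mul_abs_self (laguerreFun α k y)]
  nlinarith [sq_nonneg (|laguerreFun α k y| - ‖f y‖), sq_nonneg (|laguerreFun α k y|),
    sq_nonneg ‖f y‖]

theorem hasSum_integral_laguerreFun_mul (hα : ∀ i, -1 < α i) {c : (Fin d → ℕ) → ℝ}
    (hc : Summable fun k => |c k|) {g : (Fin d → ℝ) → ℝ}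
    (hg : ∀ y ∈ orthant d, HasSum (fun k => c k * laguerreFun α k y) (g y))
    {f : (Fin d → ℝ) → 𝕜} (hf : MemLp f 2 (orthantMeasure d)) :
    HasSum (fun k => (c k : 𝕜) * ∫ y, (laguerreFun α k y : 𝕜) * f y ∂orthantMeasure d)
      (∫ y, (g y : 𝕜) * f y ∂orthantMeasure d) := by
  have hint : ∀ k, Integrable (fun y => (c k : 𝕜) * ((laguerreFun α k y : 𝕜) * f y))
      (orthantMeasure d) := fun k => ((memLp_laguerreFun hα k).integrable_mul hf).const_mul _
  have hsummable : Summable fun k =>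
      ∫ y, ‖(c k : 𝕜) * ((laguerreFun α k y : 𝕜) * f y)‖ ∂orthantMeasure d := by
    refine (hc.mul_right (1 + ∫ y, ‖f y‖ ^ 2 ∂orthantMeasure d)).of_nonneg_of_le
      (fun k => integral_nonneg fun y => norm_nonneg _) fun k => ?_
    simp only [norm_mul (c k : 𝕜), RCLike.norm_ofReal, integral_const_mul]
    exact mul_le_mul_of_nonneg_left (integral_norm_laguerreFun_mul_le hα k hf) (abs_nonneg _)
  have hsum := hasSum_integral_of_summable_integral_norm hint hsummable
  simp only [integral_const_mul] at hsum
  rwa [integral_congr_ae (g := fun y => (g y : 𝕜) * f y)] at hsum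
  filter_upwards [ae_mem_orthant d] with y hy
  simp only [← mul_assoc, ← RCLike.ofReal_mul]
  rw [tsum_mul_right, ← RCLike.ofReal_tsum, (hg y hy).tsum_eq]

end LaguerreFunctions

section ProductSeries

theorem hasSum_mul_prod {ι κ : Type*} {f : ι → ℝ} {g : κ → ℝ} {s t : ℝ} (hf : HasSum f s)
    (hg : HasSum g t) : HasSum (fun p : ι × κ => f p.1 * g p.2) (s * t) :=
  hf.mul hg (summable_mul_of_summable_norm hf.summable.norm hg.summable.norm)

theorem hasSum_prod_pi {d : ℕ} {f : Fin d → ℕ → ℝ} {s : Fin d → ℝ} (h : ∀ i, HasSum (f i) (s i)) :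
    HasSum (fun k : Fin d → ℕ => ∏ i, f i (k i)) (∏ i, s i) := by
  induction d with
  | zero =>
    simp only [Finset.univ_eq_empty, Finset.prod_empty]
    exact hasSum_unique _
  | succ d ih =>
    rw [Fin.prod_univ_succ, ← (Fin.consEquiv fun _ => ℕ).hasSum_iff]
    refine (hasSum_mul_prod (h 0) (ih (f := fun i => f i.succ) fun i => h i.succ)).congr_fun
      fun p => ?_
    simp [Fin.prod_univ_succ, Fin.consEquiv]

end ProductSeries

section HeatKernelPi

variable {d : ℕ} {α : Fin d → ℝ} {𝕜 : Type*} [RCLike 𝕜] {t : ℝ} {x y : Fin d → ℝ}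

theorem exp_laguerreEigenvalue (α : Fin d → ℝ) (t : ℝ) (k : Fin d → ℕ) :
    Real.exp (-t * laguerreEigenvalue α k) = ∏ i, Real.exp (-t * (k i + (α i + 1) / 2)) := by
  rw [← Real.exp_sum, ← Finset.mul_sum, laguerreEigenvalue, Finset.sum_add_distrib,
    ← Finset.sum_div, Finset.sum_add_distrib]
  simp

theorem summable_exp_laguerreEigenvalue (α : Fin d → ℝ) (ht : 0 < t) :
    Summable fun k => Real.exp (-t * laguerreEigenvalue α k) := by
  have hgeom : ∀ i, Summable fun n : ℕ => Real.exp (-t * (n + (α i + 1) / 2)) := fun i => by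
    refine ((summable_geometric_of_lt_one (Real.exp_pos (-t)).le
      (Real.exp_lt_one_iff.2 (by linarith))).mul_right (Real.exp (-t * ((α i + 1) / 2)))).congr
      fun n => ?_
    rw [← Real.exp_nat_mul, ← Real.exp_add]
    ring_nf
  simp only [exp_laguerreEigenvalue]
  exact (hasSum_prod_pi fun i => (hgeom i).hasSum).summable

/-- The Laguerre heat kernel in several variables as a product of one-dimensional kernels. -/
noncomputable def laguerreHeatPi (α : Fin d → ℝ) (t : ℝ) (x y : Fin d → ℝ) : ℝ :=
  ∏ i, laguerreHeat (α i) t (x i) (y i)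

theorem hasSum_laguerreHeatPi (hα : ∀ i, -1 < α i) (ht : 0 < t) (hx : x ∈ orthant d)
    (hy : y ∈ orthant d) :
    HasSum (fun k => Real.exp (-t * laguerreEigenvalue α k) * laguerreFun α k x * laguerreFun α k y)
      (laguerreHeatPi α t x y) := by
  refine (hasSum_prod_pi fun i => hasSum_laguerreHeat (hα i) ht (hx i) (hy i)).congr_fun
    fun k => ?_
  rw [exp_laguerreEigenvalue, laguerreFun, laguerreFun, Finset.prod_mul_distrib,
    Finset.prod_mul_distrib]

theorem laguerreKernel_eq (hα : ∀ i, -1 < α i) (ht : 0 < t) (hx : x ∈ orthant d)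
    (hy : y ∈ orthant d) : laguerreKernel α t x y = laguerreHeatPi α t x y :=
  (hasSum_laguerreHeatPi hα ht hx hy).tsum_eq

theorem laguerreHeatPi_comm (t : ℝ) (x y : Fin d → ℝ) :
    laguerreHeatPi α t x y = laguerreHeatPi α t y x :=
  Finset.prod_congr rfl fun i _ => laguerreHeat_comm (α i) t (x i) (y i)

theorem laguerreHeatPi_nonneg (hα : ∀ i, -1 < α i) (ht : 0 < t) (hx : x ∈ orthant d)
    (hy : y ∈ orthant d) : 0 ≤ laguerreHeatPi α t x y :=
  Finset.prod_nonneg fun i _ => laguerreHeat_nonneg (hα i) ht (hx i) (hy i)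

theorem laguerreHeatPi_le (hα : ∀ i, 0 ≤ α i) (ht : 0 < t) (hx : x ∈ orthant d)
    (hy : y ∈ orthant d) : laguerreHeatPi α t x y ≤ (2 * Real.sinh (t / 2))⁻¹ ^ d :=
  (Finset.prod_le_prod
    (fun i _ => laguerreHeat_nonneg (neg_one_lt_zero.trans_le (hα i)) ht (hx i) (hy i))
    fun i _ => laguerreHeat_le (hα i) ht (hx i) (hy i)).trans_eq (by simp)

theorem measurable_laguerreHeatPi (hα : ∀ i, -1 < α i) (t : ℝ) :
    Measurable fun p : (Fin d → ℝ) × (Fin d → ℝ) => laguerreHeatPi α t p.1 p.2 :=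
  Finset.measurable_fun_prod _ fun i _ => (measurable_laguerreHeat (hα i) t).comp
    (by fun_prop : Measurable fun p : (Fin d → ℝ) × (Fin d → ℝ) => (p.1 i, p.2 i))

theorem measurable_laguerreHeatPi_right (hα : ∀ i, -1 < α i) (t : ℝ) (x : Fin d → ℝ) :
    Measurable (laguerreHeatPi α t x) :=
  Measurable.of_uncurry_left (f := laguerreHeatPi α t) (measurable_laguerreHeatPi hα t)

theorem integrableOn_laguerreHeat {a : ℝ} (ha : 0 ≤ a) (ht : 0 < t) {u : ℝ} (hu : 0 < u) :
    IntegrableOn (laguerreHeat a t u) (Set.Ioi 0) := by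
  have ha' : -1 < a := neg_one_lt_zero.trans_le ha
  refine ⟨((measurable_laguerreHeat ha' t).comp measurable_prodMk_left).aestronglyMeasurable, ?_⟩
  rw [hasFiniteIntegral_iff_ofReal ((ae_restrict_mem measurableSet_Ioi).mono
    fun v hv => laguerreHeat_nonneg ha' ht hu hv)]
  exact (lintegral_laguerreHeat_le ha ht hu).trans_lt ENNReal.ofReal_lt_top

theorem integral_laguerreHeat_le {a : ℝ} (ha : 0 ≤ a) (ht : 0 < t) {u : ℝ} (hu : 0 < u) :
    ∫ v in Set.Ioi (0 : ℝ), laguerreHeat a t u v ≤ (Real.cosh (t / 2))⁻¹ := by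
  have hle := lintegral_laguerreHeat_le ha ht hu
  rwa [← ofReal_integral_eq_lintegral_ofReal (integrableOn_laguerreHeat ha ht hu)
      ((ae_restrict_mem measurableSet_Ioi).mono
        fun v hv => laguerreHeat_nonneg (neg_one_lt_zero.trans_le ha) ht hu hv),
    ENNReal.ofReal_le_ofReal_iff (inv_nonneg.2 (Real.cosh_pos _).le)] at hle

theorem integrable_laguerreHeatPi (hα : ∀ i, 0 ≤ α i) (ht : 0 < t) (hx : x ∈ orthant d) :
    Integrable (laguerreHeatPi α t x) (orthantMeasure d) := by
  rw [orthantMeasure_eq_pi]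
  exact Integrable.fintype_prod (f := fun i v => laguerreHeat (α i) t (x i) v)
    fun i => integrableOn_laguerreHeat (hα i) ht (hx i)

theorem integral_laguerreHeatPi_le (hα : ∀ i, 0 ≤ α i) (ht : 0 < t) (hx : x ∈ orthant d) :
    ∫ y, laguerreHeatPi α t x y ∂orthantMeasure d ≤ (Real.cosh (t / 2) ^ d)⁻¹ := by
  simp only [orthantMeasure_eq_pi, laguerreHeatPi]
  rw [integral_fintype_prod_eq_prod (f := fun i v => laguerreHeat (α i) t (x i) v)]
  refine (Finset.prod_le_prod (fun i _ => setIntegral_nonneg measurableSet_Ioi fun v hv =>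
      laguerreHeat_nonneg (neg_one_lt_zero.trans_le (hα i)) ht (hx i) hv)
    fun i _ => integral_laguerreHeat_le (hα i) ht (hx i)).trans_eq (by simp)

theorem lintegral_laguerreHeatPi_le (hα : ∀ i, 0 ≤ α i) (ht : 0 < t) (hx : x ∈ orthant d) :
    ∫⁻ y, ENNReal.ofReal (laguerreHeatPi α t x y) ∂orthantMeasure d ≤
      ENNReal.ofReal (Real.cosh (t / 2) ^ d)⁻¹ := by
  rw [← ofReal_integral_eq_lintegral_ofReal (integrable_laguerreHeatPi hα ht hx)
    ((ae_mem_orthant d).mono fun y hy =>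
      laguerreHeatPi_nonneg (fun i => neg_one_lt_zero.trans_le (hα i)) ht hx hy)]
  exact ENNReal.ofReal_le_ofReal (integral_laguerreHeatPi_le hα ht hx)

theorem memLp_laguerreHeatPi (hα : ∀ i, 0 ≤ α i) (ht : 0 < t) (hx : x ∈ orthant d) :
    MemLp (laguerreHeatPi α t x) 2 (orthantMeasure d) := by
  have hα' : ∀ i, -1 < α i := fun i => neg_one_lt_zero.trans_le (hα i)
  have hmeas :=
    (measurable_laguerreHeatPi_right hα' t x).aestronglyMeasurable (μ := orthantMeasure d)
  rw [memLp_two_iff_integrable_sq hmeas]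
  refine ((integrable_laguerreHeatPi hα ht hx).const_mul ((2 * Real.sinh (t / 2))⁻¹ ^ d)).mono'
    (hmeas.pow 2) ?_
  filter_upwards [ae_mem_orthant d] with y hy
  have hnonneg := laguerreHeatPi_nonneg hα' ht hx hy
  rw [Real.norm_of_nonneg (by positivity), sq]
  exact mul_le_mul_of_nonneg_right (laguerreHeatPi_le hα ht hx hy) hnonneg

theorem summable_exp_mul_abs_laguerreFun (hα : ∀ i, -1 < α i) (ht : 0 < t) (hx : x ∈ orthant d) :
    Summable fun k => |Real.exp (-t * laguerreEigenvalue α k) * laguerreFun α k x| := by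
  refine ((summable_exp_laguerreEigenvalue α ht).add
    (hasSum_laguerreHeatPi hα ht hx hx).summable).of_nonneg_of_le (fun k => abs_nonneg _)
    fun k => ?_
  have habs : |laguerreFun α k x| ≤ 1 + |laguerreFun α k x| ^ 2 := by
    nlinarith [abs_nonneg (laguerreFun α k x), sq_nonneg (|laguerreFun α k x| - 1)]
  rw [abs_mul, abs_of_pos (Real.exp_pos _), mul_assoc, ← sq, ← sq_abs, ← mul_one_add]
  exact mul_le_mul_of_nonneg_left habs (Real.exp_pos _).le

theorem hasSum_integral_laguerreHeatPi_mul (hα : ∀ i, -1 < α i) (ht : 0 < t) (hx : x ∈ orthant d)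
    {f : (Fin d → ℝ) → 𝕜} (hf : MemLp f 2 (orthantMeasure d)) :
    HasSum (fun k => ((Real.exp (-t * laguerreEigenvalue α k) * laguerreFun α k x : ℝ) : 𝕜) *
      ∫ y, (laguerreFun α k y : 𝕜) * f y ∂orthantMeasure d)
      (∫ y, (laguerreHeatPi α t x y : 𝕜) * f y ∂orthantMeasure d) :=
  hasSum_integral_laguerreFun_mul hα (summable_exp_mul_abs_laguerreFun hα ht hx)
    (fun _ hy => hasSum_laguerreHeatPi hα ht hx hy) hf

theorem integral_laguerreFun_mul_laguerreHeatPi (hα : ∀ i, -1 < α i) (ht : 0 < t)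
    (hx : x ∈ orthant d) (k : Fin d → ℕ) :
    ∫ y, laguerreFun α k y * laguerreHeatPi α t x y ∂orthantMeasure d =
      Real.exp (-t * laguerreEigenvalue α k) * laguerreFun α k x := by
  have hsum := hasSum_integral_laguerreHeatPi_mul (𝕜 := ℝ) hα ht hx (memLp_laguerreFun hα k)
  simp only [RCLike.ofReal_real_eq_id, id, integral_laguerreFun_mul hα] at hsum
  simp only [mul_comm (laguerreFun α k _)]
  refine hsum.unique ((hasSum_ite_eq k
    (Real.exp (-t * laguerreEigenvalue α k) * laguerreFun α k x)).congr_fun fun l => ?_)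
  split_ifs with hl
  · rw [hl, mul_one]
  · rw [mul_zero]

theorem integral_laguerreHeatPi_mul_laguerreHeatPi (hα : ∀ i, 0 ≤ α i) {s : ℝ} (hs : 0 < s)
    (ht : 0 < t) (hx : x ∈ orthant d) (hy : y ∈ orthant d) :
    ∫ z, laguerreHeatPi α s x z * laguerreHeatPi α t z y ∂orthantMeasure d =
      laguerreHeatPi α (s + t) x y := by
  have hα' : ∀ i, -1 < α i := fun i => neg_one_lt_zero.trans_le (hα i)
  have hsum := hasSum_integral_laguerreHeatPi_mul (𝕜 := ℝ) hα' hs hx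
    (memLp_laguerreHeatPi hα ht hy)
  simp only [RCLike.ofReal_real_eq_id, id,
    integral_laguerreFun_mul_laguerreHeatPi hα' ht hy] at hsum
  simp only [laguerreHeatPi_comm t _ y]
  refine hsum.unique ((hasSum_laguerreHeatPi hα' (add_pos hs ht) hx hy).congr_fun fun k => ?_)
  rw [neg_add, add_mul, Real.exp_add]
  ring

end HeatKernelPi

/-! ### Completeness of the Laguerre functions -/

section SeparatingSubalgebra

theorem integral_withDensity_ofReal_sub_integral_withDensity_ofReal_neg {Ω : Type*}
    [MeasurableSpace Ω] {ν : Measure Ω} {F g : Ω → ℝ} (hF : AEMeasurable F ν)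
    (hg : AEMeasurable g ν) (hgF : Integrable (fun x => g x * F x) ν) :
    ∫ x, g x ∂(ν.withDensity fun x => ENNReal.ofReal (F x)) -
      ∫ x, g x ∂(ν.withDensity fun x => ENNReal.ofReal (-F x)) = ∫ x, g x * F x ∂ν := by
  have hdensity : ∀ H : Ω → ℝ, AEMeasurable H ν →
      ∫ x, g x ∂(ν.withDensity fun x => ENNReal.ofReal (H x)) = ∫ x, max (H x) 0 * g x ∂ν :=
    fun H hH => by
      rw [integral_withDensity_eq_integral_toReal_smul₀ hH.ennreal_ofReal
        (Eventually.of_forall fun _ => ENNReal.ofReal_lt_top)]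
      simp only [ENNReal.toReal_ofReal', smul_eq_mul]
  have hint : ∀ H : Ω → ℝ, AEMeasurable H ν → (∀ x, |H x| = |F x|) →
      Integrable (fun x => max (H x) 0 * g x) ν := fun H hH habs => by
    refine hgF.mono ((hH.max aemeasurable_const).mul hg).aestronglyMeasurable
      (Eventually.of_forall fun x => ?_)
    rw [norm_mul, norm_mul, mul_comm, Real.norm_eq_abs (F x), ← habs]
    exact mul_le_mul_of_nonneg_left (abs_max_le_max_abs_abs.trans_eq (by simp)) (norm_nonneg _)
  rw [hdensity F hF, hdensity (fun x => -F x) hF.neg, ← integral_sub (hint F hF fun _ => rfl)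
    (hint (fun x => -F x) hF.neg fun x => abs_neg (F x))]
  refine integral_congr_ae (Eventually.of_forall fun x => ?_)
  simp only [← sub_mul, max_zero_sub_max_neg_zero_eq_self, mul_comm (g x)]

theorem ae_eq_zero_of_withDensity_ofReal_eq {Ω : Type*} [MeasurableSpace Ω] {ν : Measure Ω}
    {F : Ω → ℝ} (hF : Integrable F ν)
    (h : (ν.withDensity fun x => ENNReal.ofReal (F x)) =
      ν.withDensity fun x => ENNReal.ofReal (-F x)) : F =ᵐ[ν] 0 := by
  have hfin : ∫⁻ x, ENNReal.ofReal (F x) ∂ν ≠ ∞ := hF.lintegral_lt_top.ne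
  filter_upwards [(withDensity_eq_iff hF.1.aemeasurable.ennreal_ofReal
    hF.1.aemeasurable.neg.ennreal_ofReal hfin).1 h] with x hx
  have hmax := congrArg ENNReal.toReal hx
  simp only [ENNReal.toReal_ofReal', Pi.neg_apply] at hmax
  rw [← max_zero_sub_max_neg_zero_eq_self (F x), hmax, sub_self, Pi.zero_apply]

/-- The positive and the negative part of `F` are densities of two finite measures, which a
separating algebra of bounded continuous functions cannot distinguish. -/
theorem ae_eq_zero_of_forall_mem_starSubalgebra_integral_mul_eq_zero {E : Type*}
    [TopologicalSpace E] [PolishSpace E] [MeasurableSpace E] [BorelSpace E] {ν : Measure E}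
    {A : StarSubalgebra ℝ (BoundedContinuousFunction E ℝ)}
    (hA : (A.map (BoundedContinuousFunction.toContinuousMapStarₐ ℝ)).SeparatesPoints)
    {F : E → ℝ} (hF : Integrable F ν) (h : ∀ g ∈ A, ∫ x, g x * F x ∂ν = 0) : F =ᵐ[ν] 0 := by
  have := isFiniteMeasure_withDensity_ofReal hF.2
  have := isFiniteMeasure_withDensity_ofReal hF.neg.2
  refine ae_eq_zero_of_withDensity_ofReal_eq hF
    (ext_of_forall_mem_subalgebra_integral_eq_of_polish hA fun g hg => ?_)
  have hgmeas : AEStronglyMeasurable g ν := g.continuous.measurable.aestronglyMeasurable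
  rw [← sub_eq_zero, ← h g hg]
  exact integral_withDensity_ofReal_sub_integral_withDensity_ofReal_neg hF.1.aemeasurable
    hgmeas.aemeasurable (hF.bdd_mul hgmeas (Eventually.of_forall g.norm_coe_le_norm))

end SeparatingSubalgebra

section ExponentialAlgebra

variable {d : ℕ}

instance (d : ℕ) : PolishSpace (orthant d) :=
  (isOpen_orthant d).polishSpace

/-- The exponential `y ↦ exp (-∑ i, n i * y i)` as a bounded continuous function on the orthant. -/
noncomputable def orthantExp (n : Fin d → ℕ) : BoundedContinuousFunction (orthant d) ℝ :=
  BoundedContinuousFunction.ofNormedAddCommGroup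
    (fun y : orthant d => Real.exp (-∑ i, (n i : ℝ) * y.1 i))
    (Real.continuous_exp.comp (continuous_finsetSum _ fun i _ => continuous_const.mul
      ((continuous_apply i).comp continuous_subtype_val)).neg) 1 fun y => by
      rw [Real.norm_of_nonneg (Real.exp_pos _).le, Real.exp_le_one_iff, neg_nonpos]
      exact Finset.sum_nonneg fun i _ => mul_nonneg (Nat.cast_nonneg _) (y.2 i).le

theorem orthantExp_apply (n : Fin d → ℕ) (y : orthant d) :
    orthantExp n y = Real.exp (-∑ i, (n i : ℝ) * y.1 i) := rfl

/-- The exponentials `orthantExp n` as a homomorphism from the exponents `n`, written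
multiplicatively; its range is closed under products. -/
noncomputable def orthantExpHom (d : ℕ) :
    Multiplicative (Fin d → ℕ) →* BoundedContinuousFunction (orthant d) ℝ where
  toFun n := orthantExp n.toAdd
  map_one' := by
    ext y
    simp [orthantExp_apply]
  map_mul' m n := by
    ext y
    simp only [orthantExp_apply, BoundedContinuousFunction.mul_apply, ← Real.exp_add, toAdd_mul,
      Pi.add_apply, Nat.cast_add, add_mul, Finset.sum_add_distrib, neg_add]

/-- The real algebra of bounded continuous functions on the orthant generated by the exponentials
`orthantExp n`. -/
noncomputable def orthantExpAlgebra (d : ℕ) :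
    StarSubalgebra ℝ (BoundedContinuousFunction (orthant d) ℝ) where
  toSubalgebra := Algebra.adjoin ℝ (MonoidHom.mrange (orthantExpHom d))
  star_mem' {g} hg := by
    have hstar : star g = g := by
      ext y
      simp
    rwa [hstar]

theorem separatesPoints_orthantExpAlgebra (d : ℕ) :
    ((orthantExpAlgebra d).map
      (BoundedContinuousFunction.toContinuousMapStarₐ ℝ)).SeparatesPoints := by
  intro x y hxy
  obtain ⟨i, hi⟩ := Function.ne_iff.1 (Subtype.coe_ne_coe.2 hxy)
  have hmem : orthantExp (Pi.single i 1) ∈ orthantExpAlgebra d :=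
    Algebra.subset_adjoin ⟨Multiplicative.ofAdd (Pi.single i 1), rfl⟩
  refine ⟨orthantExp (Pi.single i 1), ⟨_, ⟨_, hmem, rfl⟩, rfl⟩, fun heq => hi ?_⟩
  simpa [orthantExp_apply, Pi.single_apply] using heq

theorem mem_span_range_orthantExp {g : BoundedContinuousFunction (orthant d) ℝ}
    (hg : g ∈ orthantExpAlgebra d) : g ∈ Submodule.span ℝ (Set.range (orthantExp (d := d))) := by
  change g ∈ Subalgebra.toSubmodule (Algebra.adjoin ℝ (MonoidHom.mrange (orthantExpHom d) :
    Set (BoundedContinuousFunction (orthant d) ℝ))) at hg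
  rwa [Algebra.adjoin_eq_span, Submonoid.closure_eq] at hg

theorem integral_mul_eq_zero_of_mem_orthantExpAlgebra {ν : Measure (orthant d)}
    {F : orthant d → ℝ} (hF : Integrable F ν) (h : ∀ n, ∫ y, orthantExp n y * F y ∂ν = 0)
    {g : BoundedContinuousFunction (orthant d) ℝ} (hg : g ∈ orthantExpAlgebra d) :
    ∫ y, g y * F y ∂ν = 0 := by
  have hint : ∀ g : BoundedContinuousFunction (orthant d) ℝ, Integrable (fun y => g y * F y) ν :=
    fun g => hF.bdd_mul g.continuous.measurable.aestronglyMeasurable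
      (Eventually.of_forall g.norm_coe_le_norm)
  have hspan := mem_span_range_orthantExp hg
  clear hg
  induction hspan using Submodule.span_induction with
  | mem g hg =>
    obtain ⟨n, rfl⟩ := hg
    exact h n
  | zero => simp
  | add g₁ g₂ _ _ hg₁ hg₂ =>
    simp only [BoundedContinuousFunction.coe_add, Pi.add_apply, add_mul]
    rw [integral_add (hint g₁) (hint g₂), hg₁, hg₂, add_zero]
  | smul c g _ hg =>
    simp only [BoundedContinuousFunction.coe_smul, smul_eq_mul, mul_assoc]
    rw [integral_const_mul, hg, mul_zero]

theorem ae_eq_zero_of_integral_exp_mul_eq_zero {F : (Fin d → ℝ) → ℝ}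
    (hF : Integrable F (orthantMeasure d))
    (h : ∀ n : Fin d → ℕ, ∫ y, Real.exp (-∑ i, (n i : ℝ) * y i) * F y ∂orthantMeasure d = 0) :
    F =ᵐ[orthantMeasure d] 0 := by
  have hmeas := (isOpen_orthant d).measurableSet
  have hF_subtype : Integrable (fun y : orthant d => F y) (Measure.comap Subtype.val volume) := by
    rw [orthantMeasure, ← map_comap_subtype_coe hmeas] at hF
    exact (MeasurableEmbedding.subtype_coe hmeas).integrable_map_iff.1 hF
  refine (ae_restrict_iff_subtype hmeas).2
    (ae_eq_zero_of_forall_mem_starSubalgebra_integral_mul_eq_zero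
      (separatesPoints_orthantExpAlgebra d) hF_subtype fun g hg =>
        integral_mul_eq_zero_of_mem_orthantExpAlgebra hF_subtype (fun n => ?_) hg)
  rw [← h n, orthantMeasure, ← integral_subtype_comap hmeas]
  rfl

theorem ae_eq_zero_of_integral_ofReal_exp_mul_eq_zero {𝕜 : Type*} [RCLike 𝕜]
    {F : (Fin d → ℝ) → 𝕜} (hF : Integrable F (orthantMeasure d))
    (h : ∀ n : Fin d → ℕ,
      ∫ y, (Real.exp (-∑ i, (n i : ℝ) * y i) : 𝕜) * F y ∂orthantMeasure d = 0) :
    F =ᵐ[orthantMeasure d] 0 := by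
  have hint : ∀ n : Fin d → ℕ,
      Integrable (fun y => (Real.exp (-∑ i, (n i : ℝ) * y i) : 𝕜) * F y) (orthantMeasure d) := by
    refine fun n => hF.bdd_mul (c := 1)
      (RCLike.continuous_ofReal.comp (by fun_prop)).aestronglyMeasurable ?_
    filter_upwards [ae_mem_orthant d] with y hy
    rw [RCLike.norm_ofReal, Real.abs_exp, Real.exp_le_one_iff, neg_nonpos]
    exact Finset.sum_nonneg fun i _ => mul_nonneg (Nat.cast_nonneg _) (hy i).le
  have hre := ae_eq_zero_of_integral_exp_mul_eq_zero hF.re fun n => by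
    simpa only [h n, map_zero, RCLike.re_ofReal_mul] using integral_re (hint n)
  have him := ae_eq_zero_of_integral_exp_mul_eq_zero hF.im fun n => by
    simpa only [h n, map_zero, RCLike.im_ofReal_mul] using integral_im (hint n)
  filter_upwards [hre, him] with y hre_y him_y
  exact RCLike.ext (by simpa using hre_y) (by simpa using him_y)

end ExponentialAlgebra

section GeneratingFunction

variable {a s : ℝ}

theorem laguerreFun1_zero (ha : -1 < a) (x : ℝ) :
    laguerreFun1 a 0 x = (√(Real.Gamma (a + 1)))⁻¹ * (x ^ (a / 2) * Real.exp (-x / 2)) := by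
  have hGamma : Real.Gamma (a + 1) ≠ 0 := (Real.Gamma_pos_of_pos (by linarith)).ne'
  simp only [laguerreFun1, laguerrePoly, zero_add, Finset.sum_range_one, pow_zero,
    CharP.cast_eq_zero, Nat.factorial_zero, Nat.cast_one, mul_one, one_mul, Nat.sub_self,
    div_self hGamma, Real.Gamma_one, one_div, Real.sqrt_inv, mul_assoc]

theorem laguerreFun1_zero_pos (ha : -1 < a) {x : ℝ} (hx : 0 < x) : 0 < laguerreFun1 a 0 x := by
  have := Real.Gamma_pos_of_pos (show 0 < a + 1 by linarith)
  rw [laguerreFun1_zero ha]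
  positivity

theorem hasSum_pow_mul_laguerreFun1 (ha : -1 < a) (hs : |s| < 1) (y : ℝ) :
    HasSum (fun k : ℕ => s ^ k * √(Real.Gamma (k + (a + 1)) / k.factorial) * laguerreFun1 a k y)
      ((1 - s) ^ (-(a + 1)) * √(Real.Gamma (a + 1)) *
        (Real.exp (-(s / (1 - s) * y)) * laguerreFun1 a 0 y)) := by
  have hGamma := Real.Gamma_pos_of_pos (show 0 < a + 1 by linarith)
  have hsqrt : √(Real.Gamma (a + 1)) ≠ 0 := by positivity
  have hvalue : (1 - s) ^ (-(a + 1)) * √(Real.Gamma (a + 1)) *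
      (Real.exp (-(s / (1 - s) * y)) * laguerreFun1 a 0 y) =
      (1 - s) ^ (-(a + 1)) * Real.exp (-(y * s / (1 - s))) * (y ^ (a / 2) * Real.exp (-y / 2)) := by
    rw [laguerreFun1_zero ha, div_mul_eq_mul_div, mul_comm s y]
    field_simp
  rw [hvalue]
  refine ((hasSum_laguerrePoly_mul_pow ha y hs).mul_right _).congr_fun fun k => ?_
  have hGamma_k := Gamma_natCast_add_add_one_pos ha k
  have hcancel : √(Real.Gamma (k + (a + 1)) / k.factorial) *
      √(Real.Gamma (k + 1) / Real.Gamma (k + a + 1)) = 1 := by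
    rw [Real.Gamma_nat_eq_factorial, ← add_assoc, ← Real.sqrt_mul (by positivity),
      div_mul_div_cancel₀ (by positivity), div_self hGamma_k.ne', Real.sqrt_one]
  rw [laguerreFun1]
  linear_combination (s ^ k * laguerrePoly a k y * y ^ (a / 2) * Real.exp (-y / 2)) * hcancel

theorem summable_pow_mul_sqrt_Gamma (ha : -1 < a) (hs_nonneg : 0 ≤ s) (hs : s < 1) :
    Summable fun k : ℕ => s ^ k * √(Real.Gamma (k + (a + 1)) / k.factorial) := by
  have hbinomial := (hasSum_Gamma_div_factorial_mul_pow (c := a + 1)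
    (fun m => by have := natCast_add_add_one_pos ha m; linarith)
    (by rwa [abs_of_nonneg hs_nonneg])).summable
  refine (hbinomial.add (summable_geometric_of_lt_one hs_nonneg hs)).of_nonneg_of_le
    (fun k => by positivity) fun k => ?_
  have hGamma := Gamma_natCast_add_add_one_pos ha k
  rw [add_assoc] at hGamma
  have hsqrt : √(Real.Gamma (k + (a + 1)) / k.factorial) ≤
      Real.Gamma (k + (a + 1)) / k.factorial + 1 := by
    have : 0 ≤ Real.Gamma (k + (a + 1)) / k.factorial := by positivity
    rw [Real.sqrt_le_left (by positivity)]
    nlinarith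
  exact (mul_le_mul_of_nonneg_left hsqrt (by positivity)).trans_eq (by ring)

variable {d : ℕ} {α : Fin d → ℝ}

theorem laguerreFun_zero_pos (hα : ∀ i, -1 < α i) {y : Fin d → ℝ} (hy : y ∈ orthant d) :
    0 < laguerreFun α 0 y :=
  Finset.prod_pos fun i _ => laguerreFun1_zero_pos (hα i) (hy i)

theorem hasSum_prod_pow_mul_laguerreFun (hα : ∀ i, -1 < α i) {s : Fin d → ℝ}
    (hs : ∀ i, |s i| < 1) (y : Fin d → ℝ) :
    HasSum (fun k => (∏ i, s i ^ k i * √(Real.Gamma (k i + (α i + 1)) / (k i).factorial)) *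
        laguerreFun α k y)
      ((∏ i, (1 - s i) ^ (-(α i + 1)) * √(Real.Gamma (α i + 1))) *
        (Real.exp (-∑ i, s i / (1 - s i) * y i) * laguerreFun α 0 y)) := by
  rw [← Finset.sum_neg_distrib, Real.exp_sum, laguerreFun, ← Finset.prod_mul_distrib,
    ← Finset.prod_mul_distrib]
  refine (hasSum_prod_pi fun i => hasSum_pow_mul_laguerreFun1 (hα i) (hs i) (y i)).congr_fun
    fun k => ?_
  rw [laguerreFun, ← Finset.prod_mul_distrib]

variable {𝕜 : Type*} [RCLike 𝕜]

theorem integral_exp_mul_laguerreFun_zero_mul_eq_zero (hα : ∀ i, -1 < α i)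
    {f : (Fin d → ℝ) → 𝕜} (hf : MemLp f 2 (orthantMeasure d))
    (h : ∀ k, ∫ y, (laguerreFun α k y : 𝕜) * f y ∂orthantMeasure d = 0) (n : Fin d → ℕ) :
    ∫ y, (Real.exp (-∑ i, (n i : ℝ) * y i) : 𝕜) * ((laguerreFun α 0 y : 𝕜) * f y)
      ∂orthantMeasure d = 0 := by
  -- The generating function at `s` contains the exponential with exponent `s / (1 - s) = n`.
  set s : Fin d → ℝ := fun i => n i / (n i + 1) with hs
  have hs_nonneg : ∀ i, 0 ≤ s i := fun i => by positivity
  have hs_lt : ∀ i, s i < 1 := fun i => (div_lt_one (by positivity)).2 (by linarith)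
  have hs_abs : ∀ i, |s i| < 1 := fun i => (abs_of_nonneg (hs_nonneg i)).trans_lt (hs_lt i)
  have hs_exponent : ∀ i, s i / (1 - s i) = n i := fun i => by
    have : (n i : ℝ) + 1 ≠ 0 := by positivity
    rw [hs]
    field_simp
    ring
  have hconst : (∏ i, (1 - s i) ^ (-(α i + 1)) * √(Real.Gamma (α i + 1))) ≠ 0 :=
    (Finset.prod_pos fun i _ => mul_pos (Real.rpow_pos_of_pos (sub_pos.2 (hs_lt i)) _)
      (Real.sqrt_pos.2 (Real.Gamma_pos_of_pos (by linarith [hα i])))).ne'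
  have hsummable : Summable fun k : Fin d → ℕ =>
      |∏ i, s i ^ k i * √(Real.Gamma (k i + (α i + 1)) / (k i).factorial)| :=
    (hasSum_prod_pi fun i => (summable_pow_mul_sqrt_Gamma (hα i) (hs_nonneg i)
      (hs_lt i)).hasSum).summable.abs
  have hsum := hasSum_integral_laguerreFun_mul hα hsummable
    (fun y _ => hasSum_prod_pow_mul_laguerreFun hα hs_abs y) hf
  simp only [h, mul_zero, hs_exponent, RCLike.ofReal_mul, mul_assoc, integral_const_mul] at hsum
  exact (mul_eq_zero.1 (hsum.unique hasSum_zero)).resolve_left (RCLike.ofReal_ne_zero.2 hconst)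

theorem ae_eq_zero_of_integral_laguerreFun_mul_eq_zero (hα : ∀ i, -1 < α i)
    {f : (Fin d → ℝ) → 𝕜} (hf : MemLp f 2 (orthantMeasure d))
    (h : ∀ k, ∫ y, (laguerreFun α k y : 𝕜) * f y ∂orthantMeasure d = 0) :
    f =ᵐ[orthantMeasure d] 0 := by
  have hzero := ae_eq_zero_of_integral_ofReal_exp_mul_eq_zero
    ((memLp_laguerreFun hα 0).integrable_mul hf)
    (integral_exp_mul_laguerreFun_zero_mul_eq_zero hα hf h)
  filter_upwards [hzero, ae_mem_orthant d] with y hzero_y hy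
  exact (mul_eq_zero.1 hzero_y).resolve_left
    (RCLike.ofReal_ne_zero.2 (laguerreFun_zero_pos hα hy).ne')

end GeneratingFunction

/-! ### Integral operators with symmetric Schur kernels -/

section Truncation

variable {X : Type*} [MeasurableSpace X] {μ : Measure X} {𝕜 : Type*} [RCLike 𝕜]

theorem memLp_one_indicator_one_le_norm {p : ℝ≥0∞} (hp : 1 ≤ p) (hp_top : p ≠ ∞) {f : X → 𝕜}
    (hfm : StronglyMeasurable f) (hf : MemLp f p μ) :
    MemLp ({x | 1 ≤ ‖f x‖}.indicator f) 1 μ := by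
  have hmeas : MeasurableSet {x | 1 ≤ ‖f x‖} :=
    measurableSet_le measurable_const hfm.norm.measurable
  have hfin : μ {x | 1 ≤ ‖f x‖} < ∞ :=
    hf.meas_ge_lt_top (zero_lt_one.trans_le hp).ne' hp_top one_ne_zero
  exact (hf.indicator hmeas).mono_exponent_of_measure_support_ne_top
    (fun x hx => Set.indicator_of_notMem hx f) hfin.ne hp

theorem memLp_top_indicator_compl_one_le_norm {f : X → 𝕜} (hfm : StronglyMeasurable f) :
    MemLp ({x | 1 ≤ ‖f x‖}ᶜ.indicator f) ∞ μ := by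
  have hmeas : MeasurableSet {x | 1 ≤ ‖f x‖} :=
    measurableSet_le measurable_const hfm.norm.measurable
  refine memLp_top_of_bound (hfm.indicator hmeas.compl).aestronglyMeasurable 1
    (Eventually.of_forall fun x => ?_)
  by_cases hx : 1 ≤ ‖f x‖
  · rw [Set.indicator_of_notMem (Set.notMem_compl_iff.2 hx : x ∉ {x | 1 ≤ ‖f x‖}ᶜ), norm_zero]
    exact zero_le_one
  · rw [Set.indicator_of_mem (show x ∈ {x | 1 ≤ ‖f x‖}ᶜ from hx)]
    exact (not_le.1 hx).le

theorem mem_L1AddLinfty_of_memLp {p : ℝ≥0∞} (hp : 1 ≤ p) {f : X →ₘ[μ] 𝕜} (hf : MemLp f p μ) :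
    f ∈ L1AddLinfty 𝕜 μ := by
  rcases eq_or_ne p ∞ with rfl | hp_top
  · exact Submodule.mem_sup_right (Lp.mem_Lp_iff_memLp.2 hf)
  have hlarge := memLp_one_indicator_one_le_norm hp hp_top f.stronglyMeasurable hf
  have hsmall := memLp_top_indicator_compl_one_le_norm (μ := μ) f.stronglyMeasurable
  have hsplit : f = hlarge.toLp + (hsmall.toLp : X →ₘ[μ] 𝕜) := by
    refine AEEqFun.ext ?_
    filter_upwards [AEEqFun.coeFn_add (hlarge.toLp : X →ₘ[μ] 𝕜) hsmall.toLp, hlarge.coeFn_toLp,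
      hsmall.coeFn_toLp] with x hadd hx_large hx_small
    rw [hadd, Pi.add_apply, hx_large, hx_small, Set.indicator_self_add_compl_apply]
  rw [hsplit]
  exact Submodule.add_mem_sup hlarge.toLp.2 hsmall.toLp.2

theorem one_mem_L1AddLinfty : (1 : X →ₘ[μ] 𝕜) ∈ L1AddLinfty 𝕜 μ :=
  mem_L1AddLinfty_of_memLp le_top ((memLp_congr_ae AEEqFun.coeFn_one).2 (memLp_top_const 1))

theorem exists_actsOnLpAs_of_eLpNorm_le {T : L1AddLinfty 𝕜 μ →ₗ[𝕜] (X →ₘ[μ] 𝕜)} {p : ℝ≥0∞}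
    [hp : Fact (1 ≤ p)] {C : ℝ} (hC : 0 ≤ C)
    (hT : ∀ f : L1AddLinfty 𝕜 μ,
      eLpNorm (T f) p μ ≤ ENNReal.ofReal C * eLpNorm (f : X →ₘ[μ] 𝕜) p μ) :
    ∃ A : Lp 𝕜 p μ →L[𝕜] Lp 𝕜 p μ, ActsOnLpAs T p A ∧ ‖A‖ ≤ C := by
  have hmem : ∀ f : Lp 𝕜 p μ, (f : X →ₘ[μ] 𝕜) ∈ L1AddLinfty 𝕜 μ := fun f =>
    mem_L1AddLinfty_of_memLp hp.out (Lp.memLp f)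
  have hfin : ∀ f : Lp 𝕜 p μ, ENNReal.ofReal C * eLpNorm f p μ < ∞ := fun f =>
    ENNReal.mul_lt_top ENNReal.ofReal_lt_top (Lp.eLpNorm_lt_top f)
  let A : Lp 𝕜 p μ →ₗ[𝕜] Lp 𝕜 p μ :=
    { toFun := fun f => ⟨T ⟨f, hmem f⟩,
        Lp.mem_Lp_iff_eLpNorm_lt_top.2 ((hT ⟨f, hmem f⟩).trans_lt (hfin f))⟩
      map_add' := fun f g => Subtype.ext (T.map_add ⟨f, hmem f⟩ ⟨g, hmem g⟩)
      map_smul' := fun c f => Subtype.ext (T.map_smul c ⟨f, hmem f⟩) }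
  have hA : ∀ f, ‖A f‖ ≤ C * ‖f‖ := by
    intro f
    rw [Lp.norm_def, Lp.norm_def, ← ENNReal.toReal_ofReal hC, ← ENNReal.toReal_mul]
    exact ENNReal.toReal_mono (hfin f).ne (hT ⟨f, hmem f⟩)
  exact ⟨A.mkContinuous C hA, fun f => ⟨hmem f, rfl⟩, A.mkContinuous_norm_le hC hA⟩

end Truncation

section SchurKernel

variable {X : Type*} [MeasurableSpace X] {μ : Measure X} {𝕜 : Type*} [RCLike 𝕜]

theorem one_le_toReal_of_one_le {p : ℝ≥0∞} (hp : 1 ≤ p) (hp_top : p ≠ ∞) : 1 ≤ p.toReal := by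
  simpa using ENNReal.toReal_mono hp_top hp

/-- A symmetric measurable kernel which, on a set `S` of full measure, is nonnegative, bounded by
`B` and has marginals of mass at most `C`: the hypotheses of the Schur test. The set `S` is recorded
because the integrals against the kernel have to exist at every point of `S`. -/
structure IsSchurKernel (μ : Measure X) (S : Set X) (K : X → X → ℝ) (B C : ℝ) : Prop where
  ae_mem : ∀ᵐ x ∂μ, x ∈ S
  measurable : Measurable (Function.uncurry K)
  symm : ∀ x y, K x y = K y x
  nonneg : ∀ x ∈ S, ∀ y ∈ S, 0 ≤ K x y
  le : ∀ x ∈ S, ∀ y ∈ S, K x y ≤ B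
  lintegral_le : ∀ x ∈ S, ∫⁻ y, ENNReal.ofReal (K x y) ∂μ ≤ ENNReal.ofReal C

/-- The integral of a function against a real kernel. -/
noncomputable def kernelIntegral (μ : Measure X) (K : X → X → ℝ) (f : X → 𝕜) (x : X) : 𝕜 :=
  ∫ y, (K x y : 𝕜) * f y ∂μ

theorem kernelIntegral_congr_ae {K : X → X → ℝ} {f g : X → 𝕜} (hfg : f =ᵐ[μ] g) (x : X) :
    kernelIntegral μ K f x = kernelIntegral μ K g x :=
  integral_congr_ae (hfg.mono fun y hy => by simp only [hy])

theorem kernelIntegral_ofReal (K : X → X → ℝ) (f : X → ℝ) (x : X) :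
    kernelIntegral μ K (fun y => (f y : 𝕜)) x = ((∫ y, K x y * f y ∂μ : ℝ) : 𝕜) := by
  simp only [kernelIntegral, ← RCLike.ofReal_mul]
  exact integral_ofReal

theorem kernelIntegral_one (K : X → X → ℝ) (x : X) :
    kernelIntegral μ K (1 : X → 𝕜) x = ((∫ y, K x y ∂μ : ℝ) : 𝕜) := by
  simp only [kernelIntegral, Pi.one_apply, mul_one]
  exact integral_ofReal

namespace IsSchurKernel

variable {S : Set X} {K : X → X → ℝ} {B C : ℝ}

theorem integrable_kernel (hK : IsSchurKernel μ S K B C) {x : X} (hx : x ∈ S) :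
    Integrable (K x) μ := by
  refine ⟨hK.measurable.of_uncurry_left.aestronglyMeasurable, ?_⟩
  rw [hasFiniteIntegral_iff_ofReal (hK.ae_mem.mono fun y hy => hK.nonneg x hx y hy)]
  exact (hK.lintegral_le x hx).trans_lt ENNReal.ofReal_lt_top

theorem integral_le (hK : IsSchurKernel μ S K B C) {x : X} (hx : x ∈ S) :
    ∫ y, K x y ∂μ ≤ max C 0 := by
  rw [integral_eq_lintegral_of_nonneg_ae (hK.ae_mem.mono fun y hy => hK.nonneg x hx y hy)
    hK.measurable.of_uncurry_left.aestronglyMeasurable, ← ENNReal.toReal_ofReal']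
  exact ENNReal.toReal_mono ENNReal.ofReal_ne_top (hK.lintegral_le x hx)

theorem measurable_ofReal_kernel (hK : IsSchurKernel μ S K B C) :
    Measurable fun q : X × X => (K q.1 q.2 : 𝕜) :=
  RCLike.measurable_ofReal.comp hK.measurable

theorem norm_ofReal_kernel (hK : IsSchurKernel μ S K B C) {x y : X} (hx : x ∈ S) (hy : y ∈ S) :
    ‖(K x y : 𝕜)‖ = K x y := by
  rw [RCLike.norm_ofReal, abs_of_nonneg (hK.nonneg x hx y hy)]

theorem integrable_mul (hK : IsSchurKernel μ S K B C) {f : X →ₘ[μ] 𝕜}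
    (hf : f ∈ L1AddLinfty 𝕜 μ) {x : X} (hx : x ∈ S) :
    Integrable (fun y => (K x y : 𝕜) * f y) μ := by
  obtain ⟨g, hg, h, hh, rfl⟩ := Submodule.mem_sup.1 hf
  have hg_int : Integrable g μ := memLp_one_iff_integrable.1 (Lp.mem_Lp_iff_memLp.1 hg)
  have hh_top : MemLp h ∞ μ := Lp.mem_Lp_iff_memLp.1 hh
  have hKg : Integrable (fun y => (K x y : 𝕜) * g y) μ :=
    hg_int.bdd_mul (c := B)
      (hK.measurable_ofReal_kernel.comp measurable_prodMk_left).aestronglyMeasurable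
      (hK.ae_mem.mono fun y hy => (hK.norm_ofReal_kernel hx hy).trans_le (hK.le x hx y hy))
  have hKh : Integrable (fun y => (K x y : 𝕜) * h y) μ :=
    (hK.integrable_kernel hx).ofReal.mul_of_top_left hh_top
  refine (hKg.add hKh).congr ?_
  filter_upwards [AEEqFun.coeFn_add g h] with y hy
  rw [hy, Pi.add_apply, Pi.add_apply, mul_add]

theorem integrable_kernel_mul_kernel {K₁ K₂ : X → X → ℝ} {B₁ B₂ C₁ C₂ : ℝ}
    (hK₁ : IsSchurKernel μ S K₁ B₁ C₁) (hK₂ : IsSchurKernel μ S K₂ B₂ C₂) {x y : X}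
    (hx : x ∈ S) (hy : y ∈ S) :
    Integrable (fun z => K₁ x z * K₂ z y) μ := by
  simp only [mul_comm (K₁ x _), hK₂.symm _ y]
  refine (hK₁.integrable_kernel hx).bdd_mul (c := B₂)
    hK₂.measurable.of_uncurry_left.aestronglyMeasurable (hK₂.ae_mem.mono fun z hz => ?_)
  rw [Real.norm_of_nonneg (hK₂.nonneg y hy z hz)]
  exact hK₂.le y hy z hz

theorem kernelIntegral_nonneg (hK : IsSchurKernel μ S K B C) {f : X → 𝕜}
    (hf : ∀ᵐ y ∂μ, 0 ≤ f y) {x : X} (hx : x ∈ S) : 0 ≤ kernelIntegral μ K f x := by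
  have hre : f =ᵐ[μ] fun y => ((RCLike.re (f y) : ℝ) : 𝕜) := by
    filter_upwards [hf] with y hy
    exact (RCLike.conj_eq_iff_re.1 (RCLike.conj_eq_iff_im.2 (RCLike.nonneg_iff.1 hy).2)).symm
  rw [kernelIntegral_congr_ae hre, kernelIntegral_ofReal, RCLike.ofReal_nonneg]
  refine integral_nonneg_of_ae ?_
  filter_upwards [hf, hK.ae_mem] with y hy hyS
  exact mul_nonneg (hK.nonneg x hx y hyS) (RCLike.nonneg_iff.1 hy).1

theorem enorm_kernelIntegral_le_eLpNorm_one (hK : IsSchurKernel μ S K B C) {f : X → 𝕜}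
    (hf : AEStronglyMeasurable f μ) {x : X} (hx : x ∈ S) :
    ‖kernelIntegral μ K f x‖ₑ ≤
      eLpNorm f 1 (μ.withDensity fun y => ENNReal.ofReal (K x y)) := by
  rw [eLpNorm_one_eq_lintegral_enorm, lintegral_withDensity_eq_lintegral_mul₀
    hK.measurable.of_uncurry_left.ennreal_ofReal.aemeasurable hf.enorm]
  refine (enorm_integral_le_lintegral_enorm _).trans (lintegral_mono_ae ?_)
  filter_upwards [hK.ae_mem] with y hy
  rw [enorm_mul, Pi.mul_apply, ← ofReal_norm, hK.norm_ofReal_kernel hx hy]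

/-- Hölder's inequality for the measure `K x y dy`, whose mass is at most `C`. -/
theorem enorm_kernelIntegral_le_eLpNorm_mul (hK : IsSchurKernel μ S K B C) {p : ℝ≥0∞}
    (hp : 1 ≤ p) {f : X → 𝕜} (hf : AEStronglyMeasurable f μ) {x : X} (hx : x ∈ S) :
    ‖kernelIntegral μ K f x‖ₑ ≤
      eLpNorm f p (μ.withDensity fun y => ENNReal.ofReal (K x y)) *
        ENNReal.ofReal C ^ (1 - 1 / p.toReal) := by
  have hmass : (μ.withDensity fun y => ENNReal.ofReal (K x y)) Set.univ ≤ ENNReal.ofReal C := by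
    rw [withDensity_apply _ MeasurableSet.univ, Measure.restrict_univ]
    exact hK.lintegral_le x hx
  have hexp : 0 ≤ 1 - 1 / p.toReal := by
    rcases eq_or_ne p ∞ with rfl | hp_top
    · simp
    · exact sub_nonneg.2 (div_le_one_of_le₀ (one_le_toReal_of_one_le hp hp_top)
        ENNReal.toReal_nonneg)
  have hholder := eLpNorm_le_eLpNorm_mul_rpow_measure_univ hp
    (hf.mono_ac (withDensity_absolutelyContinuous μ fun y => ENNReal.ofReal (K x y)))
  rw [ENNReal.toReal_one, div_one] at hholder
  refine (hK.enorm_kernelIntegral_le_eLpNorm_one hf hx).trans (hholder.trans ?_)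
  gcongr

theorem eLpNorm_top_kernelIntegral_le (hK : IsSchurKernel μ S K B C) {f : X → 𝕜}
    (hf : AEStronglyMeasurable f μ) :
    eLpNorm (kernelIntegral μ K f) ∞ μ ≤ ENNReal.ofReal C * eLpNorm f ∞ μ := by
  rw [eLpNorm_exponent_top]
  refine essSup_le_of_ae_le _ ?_
  filter_upwards [hK.ae_mem] with x hx
  have hholder := hK.enorm_kernelIntegral_le_eLpNorm_mul le_top hf hx
  rw [ENNReal.toReal_top, div_zero, sub_zero, ENNReal.rpow_one, mul_comm] at hholder
  refine hholder.trans (mul_le_mul_right ?_ _)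
  rw [eLpNorm_exponent_top, eLpNorm_exponent_top]
  exact essSup_mono_measure (withDensity_absolutelyContinuous _ _)

theorem enorm_kernelIntegral_rpow_le (hK : IsSchurKernel μ S K B C) {p : ℝ≥0∞} (hp : 1 ≤ p)
    (hp_top : p ≠ ∞) {f : X → 𝕜} (hf : AEStronglyMeasurable f μ) {x : X} (hx : x ∈ S) :
    ‖kernelIntegral μ K f x‖ₑ ^ p.toReal ≤
      ENNReal.ofReal C ^ (p.toReal - 1) *
        ∫⁻ y, ENNReal.ofReal (K x y) * ‖f y‖ₑ ^ p.toReal ∂μ := by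
  have hp_pos : 0 < p.toReal := zero_lt_one.trans_le (one_le_toReal_of_one_le hp hp_top)
  have hholder := ENNReal.rpow_le_rpow (hK.enorm_kernelIntegral_le_eLpNorm_mul hp hf hx) hp_pos.le
  rwa [ENNReal.mul_rpow_of_nonneg _ _ hp_pos.le,
    eLpNorm_eq_lintegral_rpow_enorm_toReal (zero_lt_one.trans_le hp).ne' hp_top, one_div,
    ENNReal.rpow_inv_rpow hp_pos.ne', ← ENNReal.rpow_mul, sub_mul, one_mul,
    inv_mul_cancel₀ hp_pos.ne', lintegral_withDensity_eq_lintegral_mul₀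
      hK.measurable.of_uncurry_left.ennreal_ofReal.aemeasurable (hf.enorm.pow_const _),
    mul_comm] at hholder

variable [SigmaFinite μ]

theorem aestronglyMeasurable_kernelIntegral (hK : IsSchurKernel μ S K B C) {f : X → 𝕜}
    (hf : AEStronglyMeasurable f μ) : AEStronglyMeasurable (kernelIntegral μ K f) μ :=
  (hK.measurable_ofReal_kernel.aestronglyMeasurable.mul hf.comp_snd).integral_prod_right'

variable (𝕜) in
/-- The integral operator on `L^1 + L^∞` with a given kernel. -/
noncomputable def op (hK : IsSchurKernel μ S K B C) : L1AddLinfty 𝕜 μ →ₗ[𝕜] (X →ₘ[μ] 𝕜) where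
  toFun f := AEEqFun.mk (kernelIntegral μ K f)
    (hK.aestronglyMeasurable_kernelIntegral (f : X →ₘ[μ] 𝕜).aestronglyMeasurable)
  map_add' f g := by
    rw [AEEqFun.mk_add_mk, AEEqFun.mk_eq_mk]
    filter_upwards [hK.ae_mem] with x hx
    rw [Submodule.coe_add, kernelIntegral_congr_ae (AEEqFun.coeFn_add _ _)]
    simp only [kernelIntegral, Pi.add_apply, mul_add]
    exact integral_add (hK.integrable_mul f.2 hx) (hK.integrable_mul g.2 hx)
  map_smul' c f := by
    rw [RingHom.id_apply, AEEqFun.smul_mk, AEEqFun.mk_eq_mk]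
    refine Eventually.of_forall fun x => ?_
    rw [Submodule.coe_smul, kernelIntegral_congr_ae (AEEqFun.coeFn_smul _ _)]
    simp only [kernelIntegral, Pi.smul_apply, smul_eq_mul, mul_left_comm _ c]
    exact integral_const_mul _ _

theorem coeFn_op (hK : IsSchurKernel μ S K B C) (f : L1AddLinfty 𝕜 μ) :
    hK.op 𝕜 f =ᵐ[μ] kernelIntegral μ K (f : X →ₘ[μ] 𝕜) :=
  AEEqFun.coeFn_mk _ _

theorem lintegral_lintegral_kernel_mul_le (hK : IsSchurKernel μ S K B C) {g : X → ℝ≥0∞}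
    (hg : AEMeasurable g μ) :
    ∫⁻ x, ∫⁻ y, ENNReal.ofReal (K x y) * g y ∂μ ∂μ ≤ ENNReal.ofReal C * ∫⁻ y, g y ∂μ := by
  have hmeas : AEMeasurable (fun q : X × X => ENNReal.ofReal (K q.1 q.2) * g q.2) (μ.prod μ) :=
    hK.measurable.ennreal_ofReal.aemeasurable.mul hg.comp_snd
  rw [lintegral_lintegral_swap hmeas, ← lintegral_const_mul'' _ hg]
  refine lintegral_mono_ae ?_
  filter_upwards [hK.ae_mem] with y hy
  simp only [hK.symm _ y]
  rw [lintegral_mul_const _ hK.measurable.of_uncurry_left.ennreal_ofReal]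
  exact mul_le_mul_left (hK.lintegral_le y hy) _

theorem lintegral_enorm_kernelIntegral_rpow_le (hK : IsSchurKernel μ S K B C) {p : ℝ≥0∞}
    (hp : 1 ≤ p) (hp_top : p ≠ ∞) {f : X → 𝕜} (hf : AEStronglyMeasurable f μ) :
    ∫⁻ x, ‖kernelIntegral μ K f x‖ₑ ^ p.toReal ∂μ ≤
      ENNReal.ofReal C ^ p.toReal * ∫⁻ y, ‖f y‖ₑ ^ p.toReal ∂μ := by
  have hfp : AEMeasurable (fun y => ‖f y‖ₑ ^ p.toReal) μ := hf.enorm.pow_const _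
  have hmeas : AEMeasurable
      (fun x => ∫⁻ y, ENNReal.ofReal (K x y) * ‖f y‖ₑ ^ p.toReal ∂μ) μ :=
    (hK.measurable.ennreal_ofReal.aemeasurable.mul hfp.comp_snd).lintegral_prod_right'
  have hexp : 0 ≤ p.toReal - 1 := sub_nonneg.2 (one_le_toReal_of_one_le hp hp_top)
  calc ∫⁻ x, ‖kernelIntegral μ K f x‖ₑ ^ p.toReal ∂μ
      ≤ ∫⁻ x, ENNReal.ofReal C ^ (p.toReal - 1) *
        ∫⁻ y, ENNReal.ofReal (K x y) * ‖f y‖ₑ ^ p.toReal ∂μ ∂μ :=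
        lintegral_mono_ae
          (hK.ae_mem.mono fun x hx => hK.enorm_kernelIntegral_rpow_le hp hp_top hf hx)
    _ = ENNReal.ofReal C ^ (p.toReal - 1) *
        ∫⁻ x, ∫⁻ y, ENNReal.ofReal (K x y) * ‖f y‖ₑ ^ p.toReal ∂μ ∂μ :=
        lintegral_const_mul'' _ hmeas
    _ ≤ ENNReal.ofReal C ^ (p.toReal - 1) *
        (ENNReal.ofReal C * ∫⁻ y, ‖f y‖ₑ ^ p.toReal ∂μ) :=
        mul_le_mul_right (hK.lintegral_lintegral_kernel_mul_le hfp) _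
    _ = ENNReal.ofReal C ^ p.toReal * ∫⁻ y, ‖f y‖ₑ ^ p.toReal ∂μ := by
        rw [← mul_assoc]
        nth_rewrite 2 [← ENNReal.rpow_one (ENNReal.ofReal C)]
        rw [← ENNReal.rpow_add_of_nonneg _ _ hexp zero_le_one, sub_add_cancel]

theorem eLpNorm_kernelIntegral_le (hK : IsSchurKernel μ S K B C) {p : ℝ≥0∞} (hp : 1 ≤ p)
    {f : X → 𝕜} (hf : AEStronglyMeasurable f μ) :
    eLpNorm (kernelIntegral μ K f) p μ ≤ ENNReal.ofReal C * eLpNorm f p μ := by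
  rcases eq_or_ne p ∞ with rfl | hp_top
  · exact hK.eLpNorm_top_kernelIntegral_le hf
  have hp_pos : 0 < p.toReal := zero_lt_one.trans_le (one_le_toReal_of_one_le hp hp_top)
  have hp_ne : p ≠ 0 := (zero_lt_one.trans_le hp).ne'
  rw [eLpNorm_eq_lintegral_rpow_enorm_toReal hp_ne hp_top,
    eLpNorm_eq_lintegral_rpow_enorm_toReal hp_ne hp_top, one_div,
    ENNReal.rpow_inv_le_iff hp_pos, ENNReal.mul_rpow_of_nonneg _ _ hp_pos.le,
    ENNReal.rpow_inv_rpow hp_pos.ne']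
  exact hK.lintegral_enorm_kernelIntegral_rpow_le hp hp_top hf

theorem integrable_prod_kernel_mul_norm_sq (hK : IsSchurKernel μ S K B C) {g : X → 𝕜}
    (hg : MemLp g 2 μ) :
    Integrable (fun q : X × X => K q.1 q.2 * ‖g q.1‖ ^ 2) (μ.prod μ) := by
  have hmeas : AEStronglyMeasurable (fun q : X × X => K q.1 q.2 * ‖g q.1‖ ^ 2) (μ.prod μ) :=
    hK.measurable.aestronglyMeasurable.mul (hg.1.comp_fst.norm.pow 2)
  have hg_sq := (memLp_two_iff_integrable_sq_norm hg.1).1 hg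
  rw [integrable_prod_iff hmeas]
  refine ⟨hK.ae_mem.mono fun x hx => (hK.integrable_kernel hx).mul_const (‖g x‖ ^ 2), ?_⟩
  refine (hg_sq.const_mul (max C 0)).mono' hmeas.norm.integral_prod_right' ?_
  filter_upwards [hK.ae_mem] with x hx
  rw [Real.norm_of_nonneg (integral_nonneg fun y => norm_nonneg _)]
  calc ∫ y, ‖K x y * ‖g x‖ ^ 2‖ ∂μ = ∫ y, K x y * ‖g x‖ ^ 2 ∂μ := by
        refine integral_congr_ae ?_
        filter_upwards [hK.ae_mem] with y hy
        exact Real.norm_of_nonneg (mul_nonneg (hK.nonneg x hx y hy) (sq_nonneg _))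
    _ = (∫ y, K x y ∂μ) * ‖g x‖ ^ 2 := integral_mul_const _ _
    _ ≤ max C 0 * ‖g x‖ ^ 2 := mul_le_mul_of_nonneg_right (hK.integral_le hx) (sq_nonneg _)

theorem integrable_prod_mul_kernel_mul (hK : IsSchurKernel μ S K B C) {f g : X → 𝕜}
    (hf : MemLp f 2 μ) (hg : MemLp g 2 μ) :
    Integrable (fun q : X × X => g q.1 * ((K q.1 q.2 : 𝕜) * f q.2)) (μ.prod μ) := by
  refine ((hK.integrable_prod_kernel_mul_norm_sq hg).add
    (hK.integrable_prod_kernel_mul_norm_sq hf).swap).mono'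
    (hg.1.comp_fst.mul (hK.measurable_ofReal_kernel.aestronglyMeasurable.mul hf.1.comp_snd)) ?_
  filter_upwards [Measure.quasiMeasurePreserving_fst.ae hK.ae_mem,
    Measure.quasiMeasurePreserving_snd.ae hK.ae_mem] with q hq_fst hq_snd
  simp only [norm_mul, hK.norm_ofReal_kernel hq_fst hq_snd, Pi.add_apply, Function.comp,
    Prod.fst_swap, Prod.snd_swap, hK.symm q.2 q.1]
  rw [← mul_add, mul_left_comm]
  refine mul_le_mul_of_nonneg_left ?_ (hK.nonneg _ hq_fst _ hq_snd)
  nlinarith [sq_nonneg (‖g q.1‖ - ‖f q.2‖), sq_nonneg ‖g q.1‖, sq_nonneg ‖f q.2‖]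

theorem integral_mul_kernelIntegral (hK : IsSchurKernel μ S K B C) {f g : X → 𝕜}
    (hf : MemLp f 2 μ) (hg : MemLp g 2 μ) :
    ∫ x, g x * kernelIntegral μ K f x ∂μ = ∫ y, kernelIntegral μ K g y * f y ∂μ := by
  calc ∫ x, g x * kernelIntegral μ K f x ∂μ = ∫ x, ∫ y, g x * ((K x y : 𝕜) * f y) ∂μ ∂μ := by
        simp only [kernelIntegral, integral_const_mul]
    _ = ∫ y, ∫ x, g x * ((K x y : 𝕜) * f y) ∂μ ∂μ :=
        integral_integral_swap (hK.integrable_prod_mul_kernel_mul hf hg)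
    _ = ∫ y, kernelIntegral μ K g y * f y ∂μ := by
        simp only [kernelIntegral, ← integral_mul_const, hK.symm, mul_left_comm, mul_assoc]

section Composition

variable {K₁ K₂ K₃ : X → X → ℝ} {B₁ B₂ B₃ C₁ C₂ C₃ : ℝ}

theorem integrable_prod_kernel_mul_kernel_mul (hK₁ : IsSchurKernel μ S K₁ B₁ C₁)
    (hK₂ : IsSchurKernel μ S K₂ B₂ C₂) (hK₃ : IsSchurKernel μ S K₃ B₃ C₃)
    (hcomp : ∀ x ∈ S, ∀ y ∈ S, ∫ z, K₁ x z * K₂ z y ∂μ = K₃ x y) {f : X →ₘ[μ] 𝕜}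
    (hf : f ∈ L1AddLinfty 𝕜 μ) {x : X} (hx : x ∈ S) :
    Integrable (fun q : X × X => (K₁ x q.1 : 𝕜) * ((K₂ q.1 q.2 : 𝕜) * f q.2)) (μ.prod μ) := by
  have hmeas₁ : Measurable fun z => (K₁ x z : 𝕜) :=
    hK₁.measurable_ofReal_kernel.comp measurable_prodMk_left
  have hmeas : AEStronglyMeasurable
      (fun q : X × X => (K₁ x q.1 : 𝕜) * ((K₂ q.1 q.2 : 𝕜) * f q.2)) (μ.prod μ) :=
    (hmeas₁.comp measurable_fst).aestronglyMeasurable.mul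
      (hK₂.measurable_ofReal_kernel.aestronglyMeasurable.mul f.aestronglyMeasurable.comp_snd)
  rw [integrable_prod_iff' hmeas]
  constructor
  · filter_upwards [hK₂.ae_mem] with y hy
    refine ((hK₁.integrable_kernel_mul_kernel hK₂ hx hy).ofReal.mul_const (f y)).congr
      (Eventually.of_forall fun z => ?_)
    simp only [RCLike.ofReal_mul, mul_assoc]
  · refine (hK₃.integrable_mul hf hx).norm.congr ?_
    filter_upwards [hK₂.ae_mem] with y hy
    rw [norm_mul, hK₃.norm_ofReal_kernel hx hy, ← hcomp x hx y hy, ← integral_mul_const]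
    refine integral_congr_ae ?_
    filter_upwards [hK₁.ae_mem] with z hz
    simp only [norm_mul, hK₁.norm_ofReal_kernel hx hz, hK₂.norm_ofReal_kernel hz hy, mul_assoc]

theorem kernelIntegral_kernelIntegral (hK₁ : IsSchurKernel μ S K₁ B₁ C₁)
    (hK₂ : IsSchurKernel μ S K₂ B₂ C₂) (hK₃ : IsSchurKernel μ S K₃ B₃ C₃)
    (hcomp : ∀ x ∈ S, ∀ y ∈ S, ∫ z, K₁ x z * K₂ z y ∂μ = K₃ x y) {f : X →ₘ[μ] 𝕜}
    (hf : f ∈ L1AddLinfty 𝕜 μ) {x : X} (hx : x ∈ S) :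
    kernelIntegral μ K₁ (kernelIntegral μ K₂ f) x = kernelIntegral μ K₃ f x := by
  calc kernelIntegral μ K₁ (kernelIntegral μ K₂ f) x
      = ∫ z, ∫ y, (K₁ x z : 𝕜) * ((K₂ z y : 𝕜) * f y) ∂μ ∂μ := by
        simp only [kernelIntegral, integral_const_mul]
    _ = ∫ y, ∫ z, (K₁ x z : 𝕜) * ((K₂ z y : 𝕜) * f y) ∂μ ∂μ :=
        integral_integral_swap (hK₁.integrable_prod_kernel_mul_kernel_mul hK₂ hK₃ hcomp hf hx)
    _ = kernelIntegral μ K₃ f x := by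
        refine integral_congr_ae ?_
        filter_upwards [hK₂.ae_mem] with y hy
        simp only [← mul_assoc, ← RCLike.ofReal_mul]
        rw [integral_mul_const, integral_ofReal, hcomp x hx y hy]

end Composition

end IsSchurKernel

end SchurKernel

/-! ### The Laguerre semigroup -/

section DiagonalOperators

variable {ι 𝕜 E : Type*} [RCLike 𝕜] [NormedAddCommGroup E] [InnerProductSpace 𝕜 E]

theorem norm_sq_eq_tsum_norm_inner_sq (b : HilbertBasis ι 𝕜 E) (x : E) :
    ‖x‖ ^ 2 = ∑' i, ‖inner 𝕜 (b i) x‖ ^ 2 := by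
  have hnorm := lp.norm_rpow_eq_tsum (p := 2) (by norm_num) (b.repr x)
  simpa [HilbertBasis.repr_apply_apply] using hnorm

theorem isSelfAdjoint_of_inner_hilbertBasis [CompleteSpace E] (b : HilbertBasis ι 𝕜 E)
    {A : E →L[𝕜] E} {c : ι → ℝ}
    (hA : ∀ i x, inner 𝕜 (b i) (A x) = (c i : 𝕜) * inner 𝕜 (b i) x) : IsSelfAdjoint A := by
  rw [ContinuousLinearMap.isSelfAdjoint_iff_isSymmetric]
  intro x y
  change inner 𝕜 (A x) y = inner 𝕜 x (A y)
  rw [← b.tsum_inner_mul_inner, ← b.tsum_inner_mul_inner]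
  refine tsum_congr fun i => ?_
  rw [← inner_conj_symm (A x), hA, hA, map_mul, RCLike.conj_ofReal, inner_conj_symm,
    mul_left_comm, mul_assoc]

theorem tendsto_of_inner_hilbertBasis {τ : Type*} {l : Filter τ} (b : HilbertBasis ι 𝕜 E)
    {x : E} {y : τ → E} {c : τ → ι → ℝ}
    (hy : ∀ s i, inner 𝕜 (b i) (y s) = (c s i : 𝕜) * inner 𝕜 (b i) x)
    (hc_mem : ∀ s i, c s i ∈ Set.Icc 0 1) (hc : ∀ i, Tendsto (fun s => c s i) l (𝓝 1)) :
    Tendsto y l (𝓝 x) := by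
  have hcoef : ∀ s i, ‖inner 𝕜 (b i) (y s - x)‖ ^ 2 = (c s i - 1) ^ 2 * ‖inner 𝕜 (b i) x‖ ^ 2 := by
    intro s i
    rw [inner_sub_right, hy, ← sub_one_mul, norm_mul, mul_pow, ← RCLike.ofReal_one,
      ← RCLike.ofReal_sub, RCLike.norm_ofReal, sq_abs]
  have hlim : ∀ i, Tendsto (fun s => (c s i - 1) ^ 2 * ‖inner 𝕜 (b i) x‖ ^ 2) l (𝓝 0) :=
    fun i => by simpa using (((hc i).sub_const 1).pow 2).mul_const (‖inner 𝕜 (b i) x‖ ^ 2)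
  have hbound : ∀ s i,
      ‖(c s i - 1) ^ 2 * ‖inner 𝕜 (b i) x‖ ^ 2‖ ≤ ‖inner 𝕜 (b i) x‖ ^ 2 := by
    intro s i
    obtain ⟨hc_nonneg, hc_le⟩ := hc_mem s i
    rw [Real.norm_of_nonneg (by positivity)]
    exact mul_le_of_le_one_left (sq_nonneg _) (by nlinarith)
  have hsq : Tendsto (fun s => ‖y s - x‖ ^ 2) l (𝓝 0) := by
    simp only [norm_sq_eq_tsum_norm_inner_sq b, hcoef]
    simpa using tendsto_tsum_of_dominated_convergence (b.orthonormal.inner_products_summable x)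
      hlim (Eventually.of_forall hbound)
  rw [tendsto_iff_norm_sub_tendsto_zero]
  simpa using hsq.sqrt

end DiagonalOperators

section ActsOnLpAs

variable {X : Type*} [MeasurableSpace X] {μ : Measure X} {𝕜 : Type*} [RCLike 𝕜]
  {D : Submodule 𝕜 (X →ₘ[μ] 𝕜)} {p : ℝ≥0∞} [Fact (1 ≤ p)]

theorem ActsOnLpAs.eq_id {A : Lp 𝕜 p μ →L[𝕜] Lp 𝕜 p μ} (hA : ActsOnLpAs D.subtype p A) :
    A = ContinuousLinearMap.id 𝕜 (Lp 𝕜 p μ) := by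
  ext1 f
  obtain ⟨_, hAf⟩ := hA f
  exact Subtype.ext hAf.symm

theorem ActsOnLpAs.eq_comp {R S T : D →ₗ[𝕜] (X →ₘ[μ] 𝕜)}
    (hRST : ∀ f (hf : S f ∈ D), R ⟨S f, hf⟩ = T f) {A B C : Lp 𝕜 p μ →L[𝕜] Lp 𝕜 p μ}
    (hA : ActsOnLpAs R p A) (hB : ActsOnLpAs S p B) (hC : ActsOnLpAs T p C) :
    C = A.comp B := by
  ext1 f
  obtain ⟨_, hSf⟩ := hB f
  obtain ⟨_, hTf⟩ := hC f
  obtain ⟨hBf, hRf⟩ := hA (B f)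
  refine Subtype.ext ?_
  rw [ContinuousLinearMap.comp_apply, ← hTf, ← hRf, ← hRST _ (hSf ▸ hBf)]
  simp only [hSf]

end ActsOnLpAs

section LaguerreBasis

variable {𝕜 : Type*} [RCLike 𝕜] {d : ℕ} {α : Fin d → ℝ}

theorem inner_toLp_laguerreFun (hα : ∀ i, -1 < α i) (k : Fin d → ℕ)
    (f : Lp 𝕜 2 (orthantMeasure d)) :
    inner 𝕜 ((memLp_laguerreFun (𝕜 := 𝕜) hα k).toLp) f =
      ∫ x, (laguerreFun α k x : 𝕜) * f x ∂orthantMeasure d := by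
  rw [L2.inner_def]
  refine integral_congr_ae ?_
  filter_upwards [(memLp_laguerreFun (𝕜 := 𝕜) hα k).coeFn_toLp] with x hx
  rw [hx, RCLike.inner_apply, RCLike.conj_ofReal, mul_comm]

theorem orthonormal_laguerreFun (hα : ∀ i, -1 < α i) :
    Orthonormal 𝕜 fun k => (memLp_laguerreFun (𝕜 := 𝕜) hα k).toLp := by
  classical
  rw [orthonormal_iff_ite]
  intro k l
  have hint : ∫ x, (laguerreFun α k x : 𝕜) *
      ((memLp_laguerreFun (𝕜 := 𝕜) hα l).toLp : (Fin d → ℝ) → 𝕜) x ∂orthantMeasure d =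
      ∫ x, ((laguerreFun α k x * laguerreFun α l x : ℝ) : 𝕜) ∂orthantMeasure d := by
    refine integral_congr_ae ?_
    filter_upwards [(memLp_laguerreFun (𝕜 := 𝕜) hα l).coeFn_toLp] with x hx
    rw [hx, RCLike.ofReal_mul]
  rw [inner_toLp_laguerreFun hα, hint, integral_ofReal, integral_laguerreFun_mul hα]
  split_ifs <;> simp

variable (𝕜) in
/-- The Laguerre functions as a Hilbert basis of `L^2` of the orthant. -/
noncomputable def laguerreBasis (hα : ∀ i, -1 < α i) :
    HilbertBasis (Fin d → ℕ) 𝕜 (Lp 𝕜 2 (orthantMeasure d)) :=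
  HilbertBasis.mkOfOrthogonalEqBot (orthonormal_laguerreFun hα) (by
    rw [Submodule.eq_bot_iff]
    intro f hf
    have hzero := ae_eq_zero_of_integral_laguerreFun_mul_eq_zero hα (Lp.memLp f) fun k => by
      rw [← inner_toLp_laguerreFun hα]
      exact (Submodule.mem_orthogonal _ _).1 hf _ (Submodule.subset_span ⟨k, rfl⟩)
    exact Lp.ext (hzero.trans (Lp.coeFn_zero 𝕜 2 (orthantMeasure d)).symm))

theorem laguerreBasis_apply (hα : ∀ i, -1 < α i) (k : Fin d → ℕ) :
    laguerreBasis 𝕜 hα k = (memLp_laguerreFun (𝕜 := 𝕜) hα k).toLp := by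
  rw [laguerreBasis, HilbertBasis.coe_mkOfOrthogonalEqBot]

theorem laguerreEigenvalue_nonneg (hα : ∀ i, -1 ≤ α i) (k : Fin d → ℕ) :
    0 ≤ laguerreEigenvalue α k := by
  have hsum : (∑ i, α i) + d = ∑ i, (α i + 1) := by simp [Finset.sum_add_distrib]
  have : 0 ≤ ∑ i, (α i + 1) := Finset.sum_nonneg fun i _ => by linarith [hα i]
  rw [laguerreEigenvalue, hsum]
  positivity

theorem kernelIntegral_laguerreFun (hα : ∀ i, -1 < α i) {t : ℝ} (ht : 0 < t) (k : Fin d → ℕ)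
    {x : Fin d → ℝ} (hx : x ∈ orthant d) :
    kernelIntegral (orthantMeasure d) (laguerreHeatPi α t) (fun y => (laguerreFun α k y : 𝕜)) x =
      (Real.exp (-t * laguerreEigenvalue α k) : 𝕜) * (laguerreFun α k x : 𝕜) := by
  rw [kernelIntegral_ofReal, ← RCLike.ofReal_mul,
    ← integral_laguerreFun_mul_laguerreHeatPi hα ht hx k]
  simp only [mul_comm]

end LaguerreBasis

section LaguerreSemigroup

variable {𝕜 : Type*} [RCLike 𝕜] {d : ℕ} {α : Fin d → ℝ}

theorem isSchurKernel_laguerreHeatPi (hα : ∀ i, 0 ≤ α i) {t : ℝ} (ht : 0 < t) :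
    IsSchurKernel (orthantMeasure d) (orthant d) (laguerreHeatPi α t)
      ((2 * Real.sinh (t / 2))⁻¹ ^ d) (Real.cosh (t / 2) ^ d)⁻¹ where
  ae_mem := ae_mem_orthant d
  measurable := measurable_laguerreHeatPi (fun i => neg_one_lt_zero.trans_le (hα i)) t
  symm := laguerreHeatPi_comm t
  nonneg _ hx _ hy := laguerreHeatPi_nonneg (fun i => neg_one_lt_zero.trans_le (hα i)) ht hx hy
  le _ hx _ hy := laguerreHeatPi_le hα ht hx hy
  lintegral_le _ hx := lintegral_laguerreHeatPi_le hα ht hx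

variable (𝕜) in
/-- The Laguerre semigroup on `L^1 + L^∞` of the orthant: integration against the closed form
`laguerreHeatPi` of the heat kernel for `t > 0`, and the identity for `t = 0`. -/
noncomputable def laguerreSemigroup (hα : ∀ i, 0 ≤ α i) (t : ℝ≥0) :
    L1AddLinfty 𝕜 (orthantMeasure d) →ₗ[𝕜] ((Fin d → ℝ) →ₘ[orthantMeasure d] 𝕜) :=
  if ht : 0 < t then (isSchurKernel_laguerreHeatPi hα (NNReal.coe_pos.2 ht)).op 𝕜
  else (L1AddLinfty 𝕜 (orthantMeasure d)).subtype

theorem laguerreSemigroup_zero (hα : ∀ i, 0 ≤ α i) :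
    laguerreSemigroup 𝕜 hα 0 = (L1AddLinfty 𝕜 (orthantMeasure d)).subtype :=
  dif_neg (lt_irrefl 0)

theorem coeFn_laguerreSemigroup (hα : ∀ i, 0 ≤ α i) {t : ℝ≥0} (ht : 0 < t)
    (f : L1AddLinfty 𝕜 (orthantMeasure d)) :
    laguerreSemigroup 𝕜 hα t f =ᵐ[orthantMeasure d] kernelIntegral (orthantMeasure d)
      (laguerreHeatPi α t) (f : (Fin d → ℝ) →ₘ[orthantMeasure d] 𝕜) := by
  rw [laguerreSemigroup, dif_pos ht]
  exact IsSchurKernel.coeFn_op _ f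

theorem eLpNorm_laguerreSemigroup_le (hα : ∀ i, 0 ≤ α i) {p : ℝ≥0∞} (hp : 1 ≤ p) (t : ℝ≥0)
    (f : L1AddLinfty 𝕜 (orthantMeasure d)) :
    eLpNorm (laguerreSemigroup 𝕜 hα t f) p (orthantMeasure d) ≤
      ENNReal.ofReal (Real.cosh (t / 2) ^ d)⁻¹ *
        eLpNorm (f : (Fin d → ℝ) →ₘ[orthantMeasure d] 𝕜) p (orthantMeasure d) := by
  rcases eq_zero_or_pos t with rfl | ht
  · simp [laguerreSemigroup_zero]
  · rw [eLpNorm_congr_ae (coeFn_laguerreSemigroup hα ht f)]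
    exact (isSchurKernel_laguerreHeatPi hα (NNReal.coe_pos.2 ht)).eLpNorm_kernelIntegral_le hp
      (AEEqFun.aestronglyMeasurable _)

theorem exists_actsOnLpAs_laguerreSemigroup (hα : ∀ i, 0 ≤ α i) (p : ℝ≥0∞) [hp : Fact (1 ≤ p)]
    (t : ℝ≥0) :
    ∃ A : Lp 𝕜 p (orthantMeasure d) →L[𝕜] Lp 𝕜 p (orthantMeasure d),
      ActsOnLpAs (laguerreSemigroup 𝕜 hα t) p A ∧ ‖A‖ ≤ (Real.cosh (t / 2) ^ d)⁻¹ :=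
  exists_actsOnLpAs_of_eLpNorm_le (inv_nonneg.2 (pow_nonneg (Real.cosh_pos _).le _))
    (eLpNorm_laguerreSemigroup_le hα hp.out t)

theorem laguerreSemigroup_laguerreSemigroup (hα : ∀ i, 0 ≤ α i) (s t : ℝ≥0)
    (f : L1AddLinfty 𝕜 (orthantMeasure d))
    (hf : laguerreSemigroup 𝕜 hα t f ∈ L1AddLinfty 𝕜 (orthantMeasure d)) :
    laguerreSemigroup 𝕜 hα s ⟨laguerreSemigroup 𝕜 hα t f, hf⟩ =
      laguerreSemigroup 𝕜 hα (s + t) f := by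
  rcases eq_zero_or_pos s with rfl | hs
  · simp [laguerreSemigroup_zero]
  rcases eq_zero_or_pos t with rfl | ht
  · simp [laguerreSemigroup_zero]
  have hs' : 0 < (s : ℝ) := NNReal.coe_pos.2 hs
  have ht' : 0 < (t : ℝ) := NNReal.coe_pos.2 ht
  refine AEEqFun.ext ?_
  filter_upwards [coeFn_laguerreSemigroup hα hs ⟨laguerreSemigroup 𝕜 hα t f, hf⟩,
    coeFn_laguerreSemigroup hα (add_pos hs ht) f, ae_mem_orthant d] with x hcomp hadd hx
  rw [hcomp, hadd, kernelIntegral_congr_ae (coeFn_laguerreSemigroup hα ht f), NNReal.coe_add]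
  exact (isSchurKernel_laguerreHeatPi hα hs').kernelIntegral_kernelIntegral
    (isSchurKernel_laguerreHeatPi hα ht') (isSchurKernel_laguerreHeatPi hα (add_pos hs' ht'))
    (fun _ hx _ hy => integral_laguerreHeatPi_mul_laguerreHeatPi hα hs' ht' hx hy) f.2 hx

theorem inner_laguerreBasis_of_actsOnLpAs (hα : ∀ i, 0 ≤ α i) {t : ℝ≥0}
    {A : Lp 𝕜 2 (orthantMeasure d) →L[𝕜] Lp 𝕜 2 (orthantMeasure d)}
    (hA : ActsOnLpAs (laguerreSemigroup 𝕜 hα t) 2 A) (k : Fin d → ℕ)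
    (f : Lp 𝕜 2 (orthantMeasure d)) :
    inner 𝕜 (laguerreBasis 𝕜 (fun i => neg_one_lt_zero.trans_le (hα i)) k) (A f) =
      (Real.exp (-t * laguerreEigenvalue α k) : 𝕜) *
        inner 𝕜 (laguerreBasis 𝕜 (fun i => neg_one_lt_zero.trans_le (hα i)) k) f := by
  have hα' : ∀ i, -1 < α i := fun i => neg_one_lt_zero.trans_le (hα i)
  rcases eq_zero_or_pos t with rfl | ht
  · rw [laguerreSemigroup_zero] at hA
    simp [hA.eq_id]
  have ht' : 0 < (t : ℝ) := NNReal.coe_pos.2 ht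
  obtain ⟨hf, hAf⟩ := hA f
  have hkernel := coeFn_laguerreSemigroup hα ht ⟨(f : (Fin d → ℝ) →ₘ[orthantMeasure d] 𝕜), hf⟩
  rw [hAf] at hkernel
  rw [laguerreBasis_apply, inner_toLp_laguerreFun hα', inner_toLp_laguerreFun hα',
    ← integral_const_mul]
  calc ∫ x, (laguerreFun α k x : 𝕜) * A f x ∂orthantMeasure d
      = ∫ x, (laguerreFun α k x : 𝕜) *
        kernelIntegral (orthantMeasure d) (laguerreHeatPi α t) f x ∂orthantMeasure d := by
        refine integral_congr_ae ?_
        filter_upwards [hkernel] with x hx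
        rw [hx]
    _ = ∫ y, kernelIntegral (orthantMeasure d) (laguerreHeatPi α t)
        (fun y => (laguerreFun α k y : 𝕜)) y * f y ∂orthantMeasure d :=
        (isSchurKernel_laguerreHeatPi hα ht').integral_mul_kernelIntegral (Lp.memLp f)
          (memLp_laguerreFun hα' k)
    _ = ∫ y, (Real.exp (-t * laguerreEigenvalue α k) : 𝕜) *
        ((laguerreFun α k y : 𝕜) * f y) ∂orthantMeasure d := by
        refine integral_congr_ae ?_
        filter_upwards [ae_mem_orthant d] with y hy
        rw [kernelIntegral_laguerreFun hα' ht' k hy, mul_assoc]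

theorem isLaguerreExp_of_actsOnLpAs (hα : ∀ i, 0 ≤ α i) {t : ℝ≥0}
    {A : Lp 𝕜 2 (orthantMeasure d) →L[𝕜] Lp 𝕜 2 (orthantMeasure d)}
    (hA : ActsOnLpAs (laguerreSemigroup 𝕜 hα t) 2 A) : IsLaguerreExp α t A := by
  have hα' : ∀ i, -1 < α i := fun i => neg_one_lt_zero.trans_le (hα i)
  refine ⟨fun k x hx => laguerreDiffOp_laguerreFun hα' k hx, laguerreBasis 𝕜 hα', fun k => ?_,
    fun f => ?_⟩
  · rw [laguerreBasis_apply]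
    exact (memLp_laguerreFun hα' k).coeFn_toLp
  · refine ((laguerreBasis 𝕜 hα').hasSum_repr (A f)).congr_fun fun k => ?_
    rw [HilbertBasis.repr_apply_apply, inner_laguerreBasis_of_actsOnLpAs hα hA, mul_smul]

theorem laguerreKernel_mul_ae_eq (hα : ∀ i, -1 < α i) {t : ℝ} (ht : 0 < t)
    (f : (Fin d → ℝ) → 𝕜) {x : Fin d → ℝ} (hx : x ∈ orthant d) :
    (fun y => (laguerreKernel α t x y : 𝕜) * f y) =ᵐ[orthantMeasure d]
      fun y => (laguerreHeatPi α t x y : 𝕜) * f y := by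
  filter_upwards [ae_mem_orthant d] with y hy
  rw [laguerreKernel_eq hα ht hx hy]

theorem isLaguerreSemigroup_laguerreSemigroup (hα : ∀ i, 0 ≤ α i) :
    IsLaguerreSemigroup α (laguerreSemigroup 𝕜 hα) where
  zero := laguerreSemigroup_zero hα
  exp_on_L2 t := by
    obtain ⟨A, hA, -⟩ := exists_actsOnLpAs_laguerreSemigroup (𝕜 := 𝕜) hα 2 t
    exact ⟨A, hA, isLaguerreExp_of_actsOnLpAs hα hA⟩
  integrable_kernel t ht f x hx := by
    rw [integrable_congr (laguerreKernel_mul_ae_eq (fun i => neg_one_lt_zero.trans_le (hα i))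
      (NNReal.coe_pos.2 ht) _ hx)]
    exact (isSchurKernel_laguerreHeatPi hα (NNReal.coe_pos.2 ht)).integrable_mul f.2 hx
  eq_integral t ht f := by
    filter_upwards [coeFn_laguerreSemigroup hα ht f, ae_mem_orthant d] with x hkernel hx
    rw [hkernel, integral_congr_ae (laguerreKernel_mul_ae_eq
      (fun i => neg_one_lt_zero.trans_le (hα i)) (NNReal.coe_pos.2 ht) _ hx), kernelIntegral]

theorem IsLaguerreSemigroup.unique
    {T T' : ℝ≥0 → L1AddLinfty 𝕜 (orthantMeasure d) →ₗ[𝕜] ((Fin d → ℝ) →ₘ[orthantMeasure d] 𝕜)}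
    (hT : IsLaguerreSemigroup α T) (hT' : IsLaguerreSemigroup α T') : T = T' := by
  funext t
  rcases eq_zero_or_pos t with rfl | ht
  · rw [hT.zero, hT'.zero]
  · exact LinearMap.ext fun f =>
      AEEqFun.ext ((hT.eq_integral t ht f).trans (hT'.eq_integral t ht f).symm)

theorem tendsto_of_actsOnLpAs_laguerreSemigroup (hα : ∀ i, 0 ≤ α i)
    {A : ℝ≥0 → Lp 𝕜 2 (orthantMeasure d) →L[𝕜] Lp 𝕜 2 (orthantMeasure d)}
    (hA : ∀ t, ActsOnLpAs (laguerreSemigroup 𝕜 hα t) 2 (A t)) (f : Lp 𝕜 2 (orthantMeasure d)) :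
    Tendsto (fun t => A t f) (𝓝[>] 0) (𝓝 f) := by
  refine tendsto_of_inner_hilbertBasis
    (laguerreBasis 𝕜 fun i => neg_one_lt_zero.trans_le (hα i))
    (c := fun t k => Real.exp (-t * laguerreEigenvalue α k))
    (fun t k => inner_laguerreBasis_of_actsOnLpAs hα (hA t) k f)
    (fun t k => ⟨(Real.exp_pos _).le, Real.exp_le_one_iff.2 ?_⟩) fun k => ?_
  · rw [neg_mul, neg_nonpos]
    exact mul_nonneg t.2 (laguerreEigenvalue_nonneg (fun i => neg_one_lt_zero.le.trans (hα i)) k)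
  · have hcont : Continuous fun t : ℝ≥0 => Real.exp (-t * laguerreEigenvalue α k) := by fun_prop
    simpa using (hcont.tendsto 0).mono_left nhdsWithin_le_nhds

theorem isSymmetricDiffusionSemigroup_laguerreSemigroup (hα : ∀ i, 0 ≤ α i) :
    IsSymmetricDiffusionSemigroup (laguerreSemigroup 𝕜 hα) where
  zero := laguerreSemigroup_zero hα
  contraction_semigroup p _ := by
    choose A hA hA_norm using exists_actsOnLpAs_laguerreSemigroup (𝕜 := 𝕜) hα p
    exact ⟨A, hA,
      fun t => (hA_norm t).trans (inv_le_one_of_one_le₀ (one_le_pow₀ (Real.one_le_cosh _))),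
      (laguerreSemigroup_zero (𝕜 := 𝕜) hα ▸ hA 0).eq_id, fun s t => ActsOnLpAs.eq_comp
        (laguerreSemigroup_laguerreSemigroup hα s t) (hA s) (hA t) (hA (s + t))⟩
  selfAdjoint _ _ hA :=
    isSelfAdjoint_of_inner_hilbertBasis _ fun k f => inner_laguerreBasis_of_actsOnLpAs hα hA k f
  tendsto_zero _ hA f := tendsto_of_actsOnLpAs_laguerreSemigroup hα hA f

theorem laguerreSemigroup_nonneg (hα : ∀ i, 0 ≤ α i) (t : ℝ≥0)
    (f : L1AddLinfty 𝕜 (orthantMeasure d))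
    (hf : 0 ≤ (f : (Fin d → ℝ) →ₘ[orthantMeasure d] 𝕜)) : 0 ≤ laguerreSemigroup 𝕜 hα t f := by
  rcases eq_zero_or_pos t with rfl | ht
  · simpa [laguerreSemigroup_zero] using hf
  have hf_ae : ∀ᵐ y ∂orthantMeasure d, 0 ≤ (f : (Fin d → ℝ) →ₘ[orthantMeasure d] 𝕜) y := by
    filter_upwards [AEEqFun.coeFn_le.2 hf, AEEqFun.coeFn_zero (μ := orthantMeasure d) (β := 𝕜)]
      with y hy hzero
    rwa [hzero] at hy
  rw [← AEEqFun.coeFn_le]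
  filter_upwards [coeFn_laguerreSemigroup hα ht f,
    AEEqFun.coeFn_zero (μ := orthantMeasure d) (β := 𝕜), ae_mem_orthant d] with x hkernel hzero hx
  rw [hkernel, hzero]
  exact (isSchurKernel_laguerreHeatPi hα (NNReal.coe_pos.2 ht)).kernelIntegral_nonneg hf_ae hx

theorem laguerreSemigroup_one (hα : ∀ i, 0 ≤ α i) {t : ℝ≥0} (ht : 0 < t)
    (h : (1 : (Fin d → ℝ) →ₘ[orthantMeasure d] 𝕜) ∈ L1AddLinfty 𝕜 (orthantMeasure d)) :
    laguerreSemigroup 𝕜 hα t ⟨1, h⟩ =ᵐ[orthantMeasure d]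
      fun x => ((∫ y, laguerreHeatPi α t x y ∂orthantMeasure d : ℝ) : 𝕜) := by
  filter_upwards [coeFn_laguerreSemigroup hα ht ⟨1, h⟩] with x hx
  rw [hx, kernelIntegral_congr_ae AEEqFun.coeFn_one, kernelIntegral_one]

theorem isSubmarkovian_laguerreSemigroup (hα : ∀ i, 0 ≤ α i) :
    IsSubmarkovian (laguerreSemigroup 𝕜 hα) where
  toIsSymmetricDiffusionSemigroup := isSymmetricDiffusionSemigroup_laguerreSemigroup hα
  positive := laguerreSemigroup_nonneg hα
  map_one_le t := by
    refine ⟨one_mem_L1AddLinfty, ?_⟩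
    rcases eq_zero_or_pos t with rfl | ht
    · simp [laguerreSemigroup_zero]
    rw [← AEEqFun.coeFn_le]
    filter_upwards [laguerreSemigroup_one (𝕜 := 𝕜) hα ht one_mem_L1AddLinfty,
      AEEqFun.coeFn_one (μ := orthantMeasure d) (β := 𝕜), ae_mem_orthant d] with x hmap hone hx
    rw [hmap, hone, Pi.one_apply, ← RCLike.ofReal_one, RCLike.ofReal_le_ofReal]
    exact (integral_laguerreHeatPi_le hα (NNReal.coe_pos.2 ht) hx).trans
      (inv_le_one_of_one_le₀ (one_le_pow₀ (Real.one_le_cosh _)))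

theorem not_isMarkovian_laguerreSemigroup (hd : d ≠ 0) (hα : ∀ i, 0 ≤ α i) :
    ¬ IsMarkovian (laguerreSemigroup 𝕜 hα) := by
  intro hMarkov
  obtain ⟨hmem, hconserv⟩ := hMarkov.conservative 1
  have hmap := laguerreSemigroup_one hα one_pos hmem
  rw [hconserv] at hmap
  obtain ⟨x, hmass, hone, hx⟩ :=
    (hmap.and ((AEEqFun.coeFn_one (μ := orthantMeasure d) (β := 𝕜)).and (ae_mem_orthant d))).exists
  rw [hone, Pi.one_apply, ← RCLike.ofReal_one, RCLike.ofReal_inj] at hmass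
  have hcosh : 1 < Real.cosh (((1 : ℝ≥0) : ℝ) / 2) := Real.one_lt_cosh.2 (by simp)
  exact ((integral_laguerreHeatPi_le hα (by simp) hx).trans_lt
    (inv_lt_one_of_one_lt₀ (one_lt_pow₀ hcosh hd))).ne hmass.symm

end LaguerreSemigroup

theorem mainTheorem2 {𝕜 : Type*} [RCLike 𝕜] (d : ℕ) (hd : 1 ≤ d) (α : Fin d → ℝ)
    (hα : ∀ i, 0 ≤ α i) :
    (∃! T : ℝ≥0 → L1AddLinfty 𝕜 (orthantMeasure d) →ₗ[𝕜]
        ((Fin d → ℝ) →ₘ[orthantMeasure d] 𝕜), IsLaguerreSemigroup α T) ∧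
    ∀ T : ℝ≥0 → L1AddLinfty 𝕜 (orthantMeasure d) →ₗ[𝕜]
        ((Fin d → ℝ) →ₘ[orthantMeasure d] 𝕜), IsLaguerreSemigroup α T →
      IsSubmarkovian T ∧ ¬ IsMarkovian T ∧
      ∀ (p : ℝ≥0∞) [Fact (1 ≤ p)] (t : ℝ≥0), 0 < t →
        ∃ A : Lp 𝕜 p (orthantMeasure d) →L[𝕜] Lp 𝕜 p (orthantMeasure d),
          ActsOnLpAs (T t) p A ∧ ‖A‖ ≤ (Real.cosh ((t : ℝ) / 2) ^ d)⁻¹ := by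
  have hT := isLaguerreSemigroup_laguerreSemigroup (𝕜 := 𝕜) hα
  refine ⟨⟨laguerreSemigroup 𝕜 hα, hT, fun T h => h.unique hT⟩, fun T h => ?_⟩
  rw [h.unique hT]
  exact ⟨isSubmarkovian_laguerreSemigroup hα,
    not_isMarkovian_laguerreSemigroup (Nat.one_le_iff_ne_zero.1 hd) hα,
    fun p _ t _ => exists_actsOnLpAs_laguerreSemigroup hα p t⟩
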